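/- Let $\mathbb{D}=\{z\in\mathbb{C}:|z|<1\}$ and, for $0<r<1$, let $\mathbb{D}_r=\{z\in\mathbb{C}:|z|<r\}$. Write $|E|$ for the area (planar Lebesgue measure) of a set $E\subset\mathbb{C}$. Let $f\colon\mathbb{D}\to\mathbb{D}$ be a bijective harmonic map, that is, a bijection of $\mathbb{D}$ onto itself that is twice continuously (real) differentiable and satisfies the Laplace equation $\Delta f=4\,\partial\bar\partial f=0$ in $\mathbb{D}$. Then $$|f(\mathbb{D}_r)|\leq|\mathbb{D}_r|=\pi r^2\qquad\text{for all }0<r<1.$$ If equality $|f(\mathbb{D}_r)|=|\mathbb{D}_r|$ holds for some $r\in(0,1)$, then $f$ is an isometry of $\mathbb{D}$ with respect to the Euclidean metric, i.e. a rotation possibly composed with a reflection: there is $a\in\mathbb{C}$ with $|a|=1$ such that either $f(z)=az$ for all $z\in\mathbb{D}$ or $f(z)=a\bar z$ for all $z\in\mathbb{D}$. -/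

import Mathlib

/-!
# Area of images of concentric discs under harmonic automorphisms of the disc

Write `f = h + conj g` with `h = ∑ aₙ zⁿ`, `g = ∑ bₙ zⁿ` holomorphic and `g 0 = 0`. By Lewy's
theorem (`norm_deriv_ne_of_injOn`) the Jacobian `|h'|² - |g'|²` has no zero, so after complex conjugation,
if necessary, `f` preserves the orientation, and the area formula and Parseval's identity give
`|f(𝔻_r)| = π ∑ n (|aₙ|² - |bₙ|²) r^{2n}` (`IsHarmonicDiscAut.exists_hasSum_volume_image`).

The coefficients are controlled through the boundary values. A bijective harmonic map is proper, so
its radial limits, which exist almost everywhere, are unimodular; since `f` is injective of degree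
one they are `e^{iξ(t)}` with `ξ` increasing and `ξ(t + 2π) = ξ(t) + 2π`
(`IsHarmonicDiscAut.exists_boundary_lift`). For `0 < u < π`, two consecutive increments of `ξ` over
intervals of length `u` are nonnegative with sum at most `2π`, and for such arcs a two-point Jensen
inequality for the sine holds even though one of them may be longer than `π`
(`Real.sin_add_sin_le`). Averaging over `t` shows that the mean of `sin (ξ(t + u) - ξ(t))` is at
most `sin u` (`integral_sin_sub_le`). By Parseval's identity this mean is `∑ (|aₙ|² - |bₙ|²) sin (n u)`
(`IsHarmonicDiscAut.tsum_sin_le_sin`).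

Finally `∑ n qⁿ sin (n u)`, the imaginary part of the Koebe function at `q e^{iu}`, is positive on
`(0, π)`. Integrating the last inequality against it with `q = r²` yields
`∑ n (|aₙ|² - |bₙ|²) r^{2n} ≤ r²` (`tsum_le_of_sin_series_le`), which is the area inequality. If
equality holds, the two sides of the integrated inequality agree, so `|a₁|² - |b₁|² = 1`; as
`∑ (|aₙ|² + |bₙ|²) ≤ 1`, all other coefficients vanish and `f(z) = a₁ z`
(`IsHarmonicDiscAut.exists_eq_mul`).

The boundary behaviour is obtained directly. Fatou's theorem follows from the Poisson formula for
`|f - f(z)|²` and the differentiability almost everywhere of a Lipschitz primitive of the boundary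
values (`IsHarmonicDiscAut.ae_exists_tendsto_starPoint`), and the monotonicity of `ξ` from a planar
Poincaré–Miranda theorem (`exists_eq_zero_of_rectangle`,
`IsHarmonicDiscAut.le_of_tendsto_im_log_lift`).
-/

section

open Set Filter Topology Metric Complex MeasureTheory InnerProductSpace

/-! ### Logarithm lifts and a planar intermediate value theorem -/

/-- A continuous function with values in the kernel `2πiℤ` of the exponential is constant. -/
theorem exists_int_eq_of_exp_eq_one {X : Type*} [TopologicalSpace X] {A : Set X}
    (hA : IsPreconnected A) {φ : X → ℂ} (hφ : ContinuousOn φ A) (h1 : ∀ x ∈ A, exp (φ x) = 1) :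
    ∃ n : ℤ, ∀ x ∈ A, φ x = n * (2 * Real.pi * I) := by
  rcases A.eq_empty_or_nonempty with rfl | ⟨x₀, hx₀⟩
  · exact ⟨0, by simp⟩
  have key : ∀ x ∈ A, ∃ n : ℤ, φ x = n * (2 * Real.pi * I) := fun x hx =>
    Complex.exp_eq_one_iff.1 (h1 x hx)
  obtain ⟨n₀, hn₀⟩ := key x₀ hx₀
  have him : ∀ (n : ℤ), ((n : ℂ) * (2 * Real.pi * I)).im = n * (2 * Real.pi) := by
    intro n; simp
  have hc : ContinuousOn (fun x => (φ x).im) A := Complex.continuous_im.comp_continuousOn hφ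
  have hJ := (hA.image _ hc).ordConnected
  -- between two distinct multiples of `2π` there is a value that is no multiple
  have hno : ∀ m : ℤ, ((m : ℝ) + 1 / 2) * (2 * Real.pi) ∉ (fun x => (φ x).im) '' A := by
    rintro m ⟨x, hx, hxm⟩
    obtain ⟨n, hn⟩ := key x hx
    simp only [hn, him] at hxm
    have : (n : ℝ) = m + 1 / 2 := mul_right_cancel₀ Real.two_pi_pos.ne' hxm
    have h2 : (2 * n : ℝ) = 2 * m + 1 := by linarith
    norm_cast at h2
    omega
  refine ⟨n₀, fun x hx => ?_⟩
  obtain ⟨n, hn⟩ := key x hx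
  have hx' : (n : ℝ) * (2 * Real.pi) ∈ (fun x => (φ x).im) '' A := ⟨x, hx, by simp only [hn, him]⟩
  have hx₀' : (n₀ : ℝ) * (2 * Real.pi) ∈ (fun x => (φ x).im) '' A :=
    ⟨x₀, hx₀, by simp only [hn₀, him]⟩
  have hpi := Real.two_pi_pos
  rcases lt_trichotomy n n₀ with hlt | heq | hlt
  · have h' : (n : ℝ) + 1 ≤ n₀ := by exact_mod_cast hlt
    exact absurd (hJ.out hx' hx₀' ⟨by nlinarith, by nlinarith⟩) (hno n)
  · rw [hn, heq]
  · have h' : (n₀ : ℝ) + 1 ≤ n := by exact_mod_cast hlt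
    exact absurd (hJ.out hx₀' hx' ⟨by nlinarith, by nlinarith⟩) (hno n₀)

/-- A connected set of reals on which the cosine is positive lies in one of its intervals of
positivity. -/
theorem exists_int_abs_sub_lt_of_cos_pos {J : Set ℝ} (hJ : IsPreconnected J)
    (hcos : ∀ x ∈ J, 0 < Real.cos x) : ∃ k : ℤ, ∀ x ∈ J, |x - k * (2 * Real.pi)| < Real.pi / 2 := by
  rcases J.eq_empty_or_nonempty with rfl | ⟨x₀, hx₀⟩
  · exact ⟨0, by simp⟩
  have hpi := Real.pi_pos
  set k : ℤ := round (x₀ / (2 * Real.pi))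
  have hk : |x₀ - k * (2 * Real.pi)| ≤ Real.pi := by
    have h1 := abs_sub_round (x₀ / (2 * Real.pi))
    have h2 : x₀ - k * (2 * Real.pi) = (x₀ / (2 * Real.pi) - k) * (2 * Real.pi) := by
      field_simp
    rw [h2, abs_mul, abs_of_pos Real.two_pi_pos]
    nlinarith
  have hcosk : ∀ x : ℝ, Real.cos (x - k * (2 * Real.pi)) = Real.cos x := fun x =>
    Real.cos_sub_int_mul_two_pi x k
  have hx₀k : |x₀ - k * (2 * Real.pi)| < Real.pi / 2 := by
    by_contra! hcon
    have : Real.cos (x₀ - k * (2 * Real.pi)) ≤ 0 := by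
      rw [← Real.cos_abs]
      exact Real.cos_nonpos_of_pi_div_two_le_of_le hcon (by linarith)
    rw [hcosk] at this
    linarith [hcos x₀ hx₀]
  have hno1 : (k * (2 * Real.pi) + Real.pi / 2) ∉ J := fun h => by
    have := hcos _ h
    rw [← hcosk, add_sub_cancel_left, Real.cos_pi_div_two] at this
    exact lt_irrefl _ this
  have hno2 : (k * (2 * Real.pi) - Real.pi / 2) ∉ J := fun h => by
    have := hcos _ h
    rw [← hcosk, sub_sub_cancel_left, Real.cos_neg, Real.cos_pi_div_two] at this
    exact lt_irrefl _ this
  refine ⟨k, fun x hx => ?_⟩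
  by_contra! hcon
  rw [abs_lt] at hx₀k
  rcases le_abs.1 hcon with h | h
  · exact hno1 (hJ.ordConnected.out hx₀ hx ⟨by linarith, by linarith⟩)
  · exact hno2 (hJ.ordConnected.out hx hx₀ ⟨by linarith, by linarith⟩)

/-- Along a connected set on which `exp ∘ ℓ` stays in an open half-plane, the imaginary part
of `ℓ` stays in one interval of length `π`. -/
theorem exists_int_im_lift {X : Type*} [TopologicalSpace X] {A : Set X}
    (hA : IsPreconnected A) {ℓ : X → ℂ} (hℓ : ContinuousOn ℓ A) (γ : ℝ)
    (hpos : ∀ x ∈ A, 0 < Real.cos ((ℓ x).im - γ)) :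
    ∃ k : ℤ, ∀ x ∈ A, |(ℓ x).im - γ - k * (2 * Real.pi)| < Real.pi / 2 := by
  have hc : ContinuousOn (fun x => (ℓ x).im - γ) A :=
    (Complex.continuous_im.comp_continuousOn hℓ).sub continuousOn_const
  obtain ⟨k, hk⟩ := exists_int_abs_sub_lt_of_cos_pos (hA.image _ hc)
    (by rintro _ ⟨x, hx, rfl⟩; exact hpos x hx)
  exact ⟨k, fun x hx => hk _ ⟨x, hx, rfl⟩⟩

theorem Convex.isSimplyConnected_of_nonempty {E : Type*} [AddCommGroup E] [Module ℝ E]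
    [TopologicalSpace E] [ContinuousAdd E] [ContinuousSMul ℝ E] {s : Set E} (hs : Convex ℝ s)
    (hne : s.Nonempty) : IsSimplyConnected s := by
  have := hs.contractibleSpace hne
  exact SimplyConnectedSpace.ofContractible s

/-- The planar Poincaré–Miranda theorem, for a rectangle. Otherwise a continuous logarithm exists
on the rectangle, while the sign conditions force its argument to increase by `2π` along the
boundary. -/
theorem exists_eq_zero_of_rectangle {D : ℝ × ℝ → ℂ} {a b c d : ℝ} (hab : a ≤ b) (hcd : c ≤ d)
    (hD : ContinuousOn D (Icc a b ×ˢ Icc c d))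
    (hleft : ∀ y ∈ Icc c d, 0 < (D (a, y)).re) (hright : ∀ y ∈ Icc c d, (D (b, y)).re < 0)
    (hbot : ∀ x ∈ Icc a b, 0 < (D (x, c)).im) (htop : ∀ x ∈ Icc a b, (D (x, d)).im < 0) :
    ∃ p ∈ Icc a b ×ˢ Icc c d, D p = 0 := by
  by_contra! hne
  let P : ℝ × ℝ → ℝ × ℝ := fun p => (projIcc a b hab p.1, projIcc c d hcd p.2)
  have hPc : Continuous P := by fun_prop
  have hPm : ∀ p, P p ∈ Icc a b ×ˢ Icc c d := fun p =>
    ⟨(projIcc a b hab p.1).2, (projIcc c d hcd p.2).2⟩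
  have hPid : ∀ x ∈ Icc a b, ∀ y ∈ Icc c d, P (x, y) = (x, y) := by
    intro x hx y hy
    simp [P, projIcc_of_mem hab hx, projIcc_of_mem hcd hy]
  have hsc : IsSimplyConnected (univ : Set (ℝ × ℝ)) :=
    convex_univ.isSimplyConnected_of_nonempty univ_nonempty
  obtain ⟨ℓ, hℓc, hℓ⟩ := Complex.exists_continuousOn_eqOn_exp_comp hsc isOpen_univ
    (hD.comp hPc.continuousOn fun p _ => hPm p)
    (by rintro ⟨p, -, hp⟩; exact hne _ (hPm p) hp)
  have hexp : ∀ x ∈ Icc a b, ∀ y ∈ Icc c d, exp (ℓ (x, y)) = D (x, y) := by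
    intro x hx y hy
    have := hℓ (mem_univ (x, y))
    simpa [hPid x hx y hy] using this
  have hre : ∀ x ∈ Icc a b, ∀ y ∈ Icc c d,
      (D (x, y)).re = Real.exp (ℓ (x, y)).re * Real.cos (ℓ (x, y)).im := by
    intro x hx y hy; rw [← hexp x hx y hy, Complex.exp_re]
  have him : ∀ x ∈ Icc a b, ∀ y ∈ Icc c d,
      (D (x, y)).im = Real.exp (ℓ (x, y)).re * Real.sin (ℓ (x, y)).im := by
    intro x hx y hy; rw [← hexp x hx y hy, Complex.exp_im]
  have ha : a ∈ Icc a b := left_mem_Icc.2 hab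
  have hb : b ∈ Icc a b := right_mem_Icc.2 hab
  have hc : c ∈ Icc c d := left_mem_Icc.2 hcd
  have hd : d ∈ Icc c d := right_mem_Icc.2 hcd
  have hv : ∀ x, ContinuousOn (fun y => ℓ (x, y)) (Icc c d) := fun x =>
    (hℓc.comp_continuous (f := fun y : ℝ => (x, y)) (by fun_prop)
      (fun _ => mem_univ _)).continuousOn
  have hh : ∀ y, ContinuousOn (fun x => ℓ (x, y)) (Icc a b) := fun y =>
    (hℓc.comp_continuous (f := fun x : ℝ => (x, y)) (by fun_prop)
      (fun _ => mem_univ _)).continuousOn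
  obtain ⟨k₀, hk₀⟩ := exists_int_im_lift isPreconnected_Icc (hv a) 0 (by
    intro y hy
    have := hleft y hy
    rw [hre a ha y hy] at this
    simpa using (pos_iff_pos_of_mul_pos this).1 (Real.exp_pos _))
  obtain ⟨k₁, hk₁⟩ := exists_int_im_lift isPreconnected_Icc (hh c) (Real.pi / 2) (by
    intro x hx
    have := hbot x hx
    rw [him x hx c hc] at this
    rw [Real.cos_sub_pi_div_two]
    exact (pos_iff_pos_of_mul_pos this).1 (Real.exp_pos _))
  obtain ⟨k₂, hk₂⟩ := exists_int_im_lift isPreconnected_Icc (hv b) Real.pi (by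
    intro y hy
    have := hright y hy
    rw [hre b hb y hy] at this
    rw [Real.cos_sub_pi]
    nlinarith [Real.exp_pos (ℓ (b, y)).re])
  obtain ⟨k₃, hk₃⟩ := exists_int_im_lift isPreconnected_Icc (hh d) (-(Real.pi / 2)) (by
    intro x hx
    have := htop x hx
    rw [him x hx d hd] at this
    rw [sub_neg_eq_add, Real.cos_add_pi_div_two]
    nlinarith [Real.exp_pos (ℓ (x, d)).re])
  have e1 := abs_lt.1 (hk₀ c hc)
  have e2 := abs_lt.1 (hk₁ a ha)
  have e3 := abs_lt.1 (hk₁ b hb)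
  have e4 := abs_lt.1 (hk₂ c hc)
  have e5 := abs_lt.1 (hk₂ d hd)
  have e6 := abs_lt.1 (hk₃ b hb)
  have e7 := abs_lt.1 (hk₃ a ha)
  have e8 := abs_lt.1 (hk₀ d hd)
  have hpi := Real.pi_pos
  -- comparison of the branches at the four corners
  have c1 : k₀ = k₁ := by
    have u1 : (k₀ : ℝ) - k₁ < 1 := by nlinarith
    have u2 : (k₁ : ℝ) - k₀ < 1 := by nlinarith
    have u1' : k₀ - k₁ < 1 := by exact_mod_cast u1
    have u2' : k₁ - k₀ < 1 := by exact_mod_cast u2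
    omega
  have c2 : k₁ = k₂ := by
    have u1 : (k₁ : ℝ) - k₂ < 1 := by nlinarith
    have u2 : (k₂ : ℝ) - k₁ < 1 := by nlinarith
    have u1' : k₁ - k₂ < 1 := by exact_mod_cast u1
    have u2' : k₂ - k₁ < 1 := by exact_mod_cast u2
    omega
  have c3 : k₃ = k₀ := by
    have u1 : (k₃ : ℝ) - k₀ < 1 := by nlinarith
    have u2 : (k₀ : ℝ) - k₃ < 1 := by nlinarith
    have u1' : k₃ - k₀ < 1 := by exact_mod_cast u1
    have u2' : k₀ - k₃ < 1 := by exact_mod_cast u2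
    omega
  have c4 : k₂ < k₃ := by
    have u1 : (k₂ : ℝ) < k₃ := by nlinarith
    exact_mod_cast u1
  omega

/-! ### Critical points of harmonic functions and Lewy's theorem -/

/-- A continuous real function takes a common value at two distinct points of a triod: it cannot
leave its value at the branch point in three different directions. -/
theorem exists_ne_map_eq_of_three_arcs {y : ℂ → ℝ} {η : Fin 3 → ℝ → ℂ} {z₀ : ℂ}
    (h0 : ∀ k, η k 0 = z₀) (hc : ∀ k, ContinuousOn (fun s => y (η k s)) (Icc 0 1))
    (hne : ∀ i j, i ≠ j → ∀ s ∈ Icc (0 : ℝ) 1, η i 1 ≠ η j s) :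
    ∃ i j, ∃ s ∈ Icc (0 : ℝ) 1, ∃ s' ∈ Icc (0 : ℝ) 1, η i s ≠ η j s' ∧
      y (η i s) = y (η j s') := by
  have h1 : (1 : ℝ) ∈ Icc (0 : ℝ) 1 := ⟨zero_le_one, le_rfl⟩
  -- two of the three arcs leave the level `y z₀` on the same side
  obtain ⟨i, j, hij, hσ⟩ := Fintype.exists_ne_map_eq_of_card_lt
    (fun k : Fin 3 => decide (y z₀ ≤ y (η k 1))) (by simp)
  have hσ' : (y z₀ ≤ y (η i 1)) ↔ (y z₀ ≤ y (η j 1)) := by simpa using hσ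
  have up : ∀ i j, i ≠ j → y z₀ ≤ y (η i 1) → y (η i 1) ≤ y (η j 1) →
      ∃ s ∈ Icc (0 : ℝ) 1, η i 1 ≠ η j s ∧ y (η i 1) = y (η j s) := by
    intro i j hij ha hb
    obtain ⟨s, hs, hs'⟩ := intermediate_value_Icc zero_le_one (hc j)
      (show y (η i 1) ∈ Icc (y (η j 0)) (y (η j 1)) from ⟨by rwa [h0], hb⟩)
    exact ⟨s, hs, hne i j hij s hs, hs'.symm⟩
  have down : ∀ i j, i ≠ j → y (η i 1) ≤ y z₀ → y (η j 1) ≤ y (η i 1) →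
      ∃ s ∈ Icc (0 : ℝ) 1, η i 1 ≠ η j s ∧ y (η i 1) = y (η j s) := by
    intro i j hij ha hb
    obtain ⟨s, hs, hs'⟩ := intermediate_value_Icc' zero_le_one (hc j)
      (show y (η i 1) ∈ Icc (y (η j 1)) (y (η j 0)) from ⟨hb, by rwa [h0]⟩)
    exact ⟨s, hs, hne i j hij s hs, hs'.symm⟩
  by_cases hi : y z₀ ≤ y (η i 1)
  · rcases le_total (y (η i 1)) (y (η j 1)) with h | h
    · obtain ⟨s, hs, h'⟩ := up i j hij hi h
      exact ⟨i, j, 1, h1, s, hs, h'⟩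
    · obtain ⟨s, hs, h'⟩ := up j i hij.symm (hσ'.1 hi) h
      exact ⟨j, i, 1, h1, s, hs, h'⟩
  · have hj : ¬ y z₀ ≤ y (η j 1) := fun h => hi (hσ'.2 h)
    push Not at hi hj
    rcases le_total (y (η j 1)) (y (η i 1)) with h | h
    · obtain ⟨s, hs, h'⟩ := down i j hij hi.le h
      exact ⟨i, j, 1, h1, s, hs, h'⟩
    · obtain ⟨s, hs, h'⟩ := down j i hij.symm hj.le h
      exact ⟨j, i, 1, h1, s, hs, h'⟩

/-- Near a zero of order at least two of a holomorphic function `Φ` (possibly of infinite order),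
at least three arcs emanate from it along which `Re Φ` vanishes: they are images of rays under a
local homeomorphism `φ`, the inverse of an `n`-th root of `Φ`. -/
theorem exists_three_arcs_re_eq_zero {Φ : ℂ → ℂ} {z₀ : ℂ} (hΦ : AnalyticAt ℂ Φ z₀)
    (h0 : Φ z₀ = 0) (h1 : deriv Φ z₀ = 0) {V : Set ℂ} (hV : V ∈ 𝓝 z₀) :
    ∃ (φ : ℂ → ℂ) (δ : ℝ) (ω : Fin 3 → ℂ), 0 < δ ∧ Function.Injective ω ∧ (∀ k, ‖ω k‖ = 1) ∧
      ContinuousOn φ (closedBall 0 δ) ∧ InjOn φ (closedBall 0 δ) ∧ MapsTo φ (closedBall 0 δ) V ∧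
      φ 0 = z₀ ∧ ∀ k, ∀ s ∈ Icc (0 : ℝ) δ, (Φ (φ (s * ω k))).re = 0 := by
  by_cases hz : ∀ᶠ z in 𝓝 z₀, Φ z = 0
  · obtain ⟨δ, hδ, hsub⟩ := Metric.nhds_basis_closedBall.mem_iff.1 (inter_mem hV hz)
    have hmem : ∀ ζ ∈ closedBall (0 : ℂ) δ, z₀ + ζ ∈ closedBall z₀ δ := fun ζ hζ => by
      simpa [mem_closedBall, dist_eq_norm] using hζ
    refine ⟨fun ζ => z₀ + ζ, δ, ![1, -1, I], hδ, ?_, ?_, by fun_prop, ?_, ?_, by simp, ?_⟩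
    · intro i j hij
      fin_cases i <;> fin_cases j <;> simp_all [Complex.ext_iff] <;> norm_num at hij
    · intro k; fin_cases k <;> simp
    · intro a _ b _ hab; simpa using hab
    · exact fun ζ hζ => (hsub (hmem ζ hζ)).1
    · intro k s hs
      have : (s : ℂ) * (![1, -1, I] : Fin 3 → ℂ) k ∈ closedBall (0 : ℂ) δ := by
        have : ‖(![1, -1, I] : Fin 3 → ℂ) k‖ = 1 := by fin_cases k <;> simp
        rw [mem_closedBall_zero_iff, norm_mul, this, mul_one, norm_real, Real.norm_eq_abs,
          abs_of_nonneg hs.1]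
        exact hs.2
      have := (hsub (hmem _ this)).2
      simp only [mem_ofPred_eq] at this
      rw [this, zero_re]
  obtain ⟨n, g, hg, hg0, hΦg'⟩ := (hΦ.exists_eventuallyEq_pow_smul_nonzero_iff).2 hz
  have hΦg : Φ =ᶠ[𝓝 z₀] fun z => (z - z₀) ^ n • g z := hΦg'
  have hn : 2 ≤ n := by
    by_contra! hlt
    have hd : deriv Φ z₀ = deriv (fun z => (z - z₀) ^ n • g z) z₀ := hΦg.deriv_eq
    have hv := hΦg.self_of_nhds
    interval_cases n
    · simp [h0] at hv; exact hg0 hv.symm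
    · have hd2 : HasDerivAt (fun z => (z - z₀) ^ 1 • g z) (g z₀) z₀ := by
        have := ((hasDerivAt_id z₀).sub_const z₀).mul hg.differentiableAt.hasDerivAt
        simpa using! this
      rw [hd2.deriv, h1] at hd
      exact hg0 hd.symm
  have hn0 : (n : ℂ) ≠ 0 := by norm_cast; omega
  set c : ℂ := exp (log (g z₀) / n)
  have hcn : c ^ n = g z₀ := by
    rw [← Complex.exp_nat_mul, mul_div_cancel₀ _ hn0, Complex.exp_log hg0]
  let r : ℂ → ℂ := fun z => exp (log (g z / g z₀) / n) * c
  have hgdiv : AnalyticAt ℂ (fun z => g z / g z₀) z₀ := hg.div analyticAt_const hg0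
  have hr : AnalyticAt ℂ r z₀ := by
    refine AnalyticAt.mul ?_ analyticAt_const
    refine AnalyticAt.cexp ((AnalyticAt.clog hgdiv ?_).div analyticAt_const hn0)
    simp [div_self hg0, Complex.one_mem_slitPlane]
  have hr0 : r z₀ ≠ 0 := mul_ne_zero (exp_ne_zero _) (exp_ne_zero _)
  have hrn : ∀ᶠ z in 𝓝 z₀, r z ^ n = g z := by
    filter_upwards [hg.continuousAt.eventually_ne hg0] with z hz
    rw [mul_pow, hcn, ← Complex.exp_nat_mul, mul_div_cancel₀ _ hn0,
      Complex.exp_log (div_ne_zero hz hg0), div_mul_cancel₀ _ hg0]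
  let w : ℂ → ℂ := fun z => (z - z₀) * r z
  have hw : HasStrictDerivAt w (r z₀) z₀ := by
    have hwa : AnalyticAt ℂ w z₀ := (analyticAt_id.sub analyticAt_const).mul hr
    have hd : HasDerivAt w (r z₀) z₀ := by
      have := ((hasDerivAt_id z₀).sub_const z₀).mul hr.differentiableAt.hasDerivAt
      simpa using! this
    rw [← hd.deriv]
    exact hwa.hasStrictDerivAt
  let e := (hw.hasStrictFDerivAt_equiv hr0).toOpenPartialHomeomorph w
  have hz₀s : z₀ ∈ e.source := (hw.hasStrictFDerivAt_equiv hr0).mem_toOpenPartialHomeomorph_source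
  have hew : ∀ z, e z = w z := fun z => rfl
  have hw0 : e z₀ = 0 := by simp [hew, w]
  have h0t : (0 : ℂ) ∈ e.target := hw0 ▸ e.map_source hz₀s
  have hes : e.symm 0 = z₀ := by rw [← hw0, e.left_inv hz₀s]
  have hcont : ContinuousAt e.symm 0 := e.continuousAt_symm h0t
  have hpow : ∀ᶠ z in 𝓝 z₀, Φ z = w z ^ n := by
    filter_upwards [hΦg, hrn] with z h1 h2
    rw [h1, mul_pow, h2, smul_eq_mul]
  have hU : {ζ | ζ ∈ e.target ∧ e.symm ζ ∈ V ∧ Φ (e.symm ζ) = w (e.symm ζ) ^ n} ∈ 𝓝 (0 : ℂ) := by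
    refine inter_mem (e.open_target.mem_nhds h0t) (inter_mem ?_ ?_)
    · exact hcont.preimage_mem_nhds (by rwa [hes])
    · exact hcont.preimage_mem_nhds (by rw [hes]; exact hpow)
  obtain ⟨δ, hδ, hsub⟩ := Metric.nhds_basis_closedBall.mem_iff.1 hU
  have hnpos : (0 : ℝ) < n := by positivity
  let θ : Fin 3 → ℝ := fun k => (Real.pi / 2 + Real.pi * k.val) / n
  refine ⟨e.symm, δ, fun k => exp (θ k * I), hδ, ?_, fun k => norm_exp_ofReal_mul_I _,
    e.continuousOn_symm.mono fun ζ hζ => (hsub hζ).1,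
    e.symm.injOn.mono fun ζ hζ => (hsub hζ).1, fun ζ hζ => (hsub hζ).2.1, hes, ?_⟩
  · -- the angles differ by less than `2π` since `2 ≤ n`
    intro i j hij
    obtain ⟨m, hm⟩ := Complex.exp_eq_exp_iff_exists_int.1 hij
    have hm' : θ i - θ j = m * (2 * Real.pi) := by
      have := congrArg Complex.im hm
      simp at this
      linarith
    have h3 : ((i.val : ℝ) - j.val) = 2 * m * n := by
      have hpi := Real.pi_pos
      simp only [θ] at hm'
      field_simp at hm'
      nlinarith
    have h4 : (i.val : ℤ) - j.val = 2 * m * n := by exact_mod_cast h3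
    have hm0 : m = 0 := by
      have hi := i.2
      have hj := j.2
      by_contra hm0
      rcases lt_or_gt_of_ne hm0 with h | h
      · nlinarith
      · nlinarith
    rw [hm0] at h4
    exact Fin.ext (by omega)
  · intro k s hs
    have hmem : (s : ℂ) * exp (θ k * I) ∈ closedBall (0 : ℂ) δ := by
      rw [mem_closedBall_zero_iff, norm_mul, norm_exp_ofReal_mul_I, mul_one, norm_real,
        Real.norm_eq_abs, abs_of_nonneg hs.1]
      exact hs.2
    have hn' : (n : ℝ) ≠ 0 := hnpos.ne'
    have harg : (n : ℂ) * (θ k * I) = ((Real.pi / 2 + k.val * Real.pi : ℝ) : ℂ) * I := by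
      simp only [θ]
      push_cast
      field_simp
    rw [(hsub hmem).2.2, ← hew, e.right_inv (hsub hmem).1, mul_pow, ← Complex.exp_nat_mul, harg,
      ← ofReal_pow, re_ofReal_mul, Complex.exp_ofReal_mul_I_re, Real.cos_add_nat_mul_pi]
    simp

/-- A real function `y` is never injective on the zero set of `Re Φ` near a critical zero
of `Φ`. -/
theorem exists_ne_map_eq_of_deriv_eq_zero {Φ : ℂ → ℂ} {z₀ : ℂ} (hΦ : AnalyticAt ℂ Φ z₀)
    (h0 : Φ z₀ = 0) (h1 : deriv Φ z₀ = 0) {V : Set ℂ} (hV : V ∈ 𝓝 z₀) {y : ℂ → ℝ}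
    (hy : ContinuousOn y V) :
    ∃ z₁ ∈ V, ∃ z₂ ∈ V, z₁ ≠ z₂ ∧ (Φ z₁).re = 0 ∧ (Φ z₂).re = 0 ∧ y z₁ = y z₂ := by
  obtain ⟨φ, δ, ω, hδ, hω, hω1, hc, hinj, hmaps, hφ0, hre⟩ :=
    exists_three_arcs_re_eq_zero hΦ h0 h1 hV
  have hmem : ∀ k, ∀ s ∈ Icc (0 : ℝ) 1, ((s * δ : ℝ) : ℂ) * ω k ∈ closedBall (0 : ℂ) δ := by
    intro k s hs
    rw [mem_closedBall_zero_iff, norm_mul, hω1, mul_one, norm_real, Real.norm_eq_abs,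
      abs_of_nonneg (mul_nonneg hs.1 hδ.le)]
    exact mul_le_of_le_one_left hδ.le hs.2
  have hre' : ∀ k, ∀ s ∈ Icc (0 : ℝ) 1, (Φ (φ (((s * δ : ℝ) : ℂ) * ω k))).re = 0 := fun k s hs =>
    hre k _ ⟨mul_nonneg hs.1 hδ.le, mul_le_of_le_one_left hδ.le hs.2⟩
  obtain ⟨i, j, s, hs, s', hs', hne, heq⟩ := exists_ne_map_eq_of_three_arcs (y := y)
    (η := fun k s => φ (((s * δ : ℝ) : ℂ) * ω k)) (z₀ := z₀) (by simp [hφ0])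
    (fun k => (hy.comp hc hmaps).comp (by fun_prop) (hmem k)) (by
      intro i j hij s hs h
      have h' := hinj (hmem i 1 ⟨zero_le_one, le_rfl⟩) (hmem j s hs) h
      have hn := congrArg (‖·‖) h'
      simp only [norm_mul, hω1, norm_real, Real.norm_eq_abs, mul_one] at hn
      rw [abs_one, abs_of_nonneg hs.1] at hn
      rw [← mul_right_cancel₀ (abs_pos.2 hδ.ne').ne' hn] at h'
      exact hij (hω (mul_left_cancel₀ (by simpa using hδ.ne') h')))
  exact ⟨_, hmaps (hmem i s hs), _, hmaps (hmem j s' hs'), hne, hre' i s hs, hre' j s' hs', heq⟩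

/-- The planar harmonic map with analytic part `h` and co-analytic part `g`. -/
noncomputable def harmonicSum (h g : ℂ → ℂ) (z : ℂ) : ℂ := h z + starRingEnd ℂ (g z)

/-- Lewy's theorem: the Jacobian `|h'|² - |g'|²` of an injective harmonic map does not vanish. -/
theorem norm_deriv_ne_of_injOn {h g : ℂ → ℂ} {U : Set ℂ} (hU : IsOpen U)
    (hh : DifferentiableOn ℂ h U) (hg : DifferentiableOn ℂ g U) (hinj : InjOn (harmonicSum h g) U)
    {z₀ : ℂ} (hz₀ : z₀ ∈ U) : ‖deriv g z₀‖ ≠ ‖deriv h z₀‖ := by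
  intro heq
  have hhd : HasDerivAt h (deriv h z₀) z₀ := (hh.differentiableAt (hU.mem_nhds hz₀)).hasDerivAt
  have hgd : HasDerivAt g (deriv g z₀) z₀ := (hg.differentiableAt (hU.mem_nhds hz₀)).hasDerivAt
  -- a unimodular `ε` with `conj ε * h' + ε * g' = 0`
  obtain ⟨ε, hε, hcrit⟩ : ∃ ε : ℂ, ‖ε‖ = 1 ∧
      starRingEnd ℂ ε * deriv h z₀ + ε * deriv g z₀ = 0 := by
    by_cases h0 : deriv g z₀ = 0
    · rw [h0, norm_zero] at heq
      exact ⟨1, norm_one, by rw [h0, norm_eq_zero.1 heq.symm]; simp⟩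
    · obtain ⟨ε, hε⟩ := IsAlgClosed.exists_pow_nat_eq (-(deriv h z₀ / deriv g z₀)) zero_lt_two
      have hn : ‖ε‖ = 1 := by
        have : ‖ε‖ ^ 2 = 1 := by
          rw [← norm_pow, hε, norm_neg, norm_div, heq, div_self]
          rw [← heq]; exact norm_ne_zero_iff.2 h0
        nlinarith [norm_nonneg ε]
      refine ⟨ε, hn, ?_⟩
      have h1 : starRingEnd ℂ ε * ε = 1 := by
        rw [mul_comm, mul_conj, normSq_eq_norm_sq, hn]; simp
      have h2 : deriv h z₀ = -(ε ^ 2 * deriv g z₀) := by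
        rw [hε]; field_simp
      rw [h2]
      linear_combination (-ε * deriv g z₀) * h1
  have hεε : starRingEnd ℂ ε * ε = 1 := by
    rw [mul_comm, mul_conj, normSq_eq_norm_sq, hε]; simp
  -- `Re Ψ` is the component of `f` in the direction `ε`, and `Ψ` is critical at `z₀`
  let Ψ : ℂ → ℂ := fun z => starRingEnd ℂ ε * h z + ε * g z
  let Φ : ℂ → ℂ := fun z => Ψ z - Ψ z₀
  have hΦd : DifferentiableOn ℂ Φ U := ((hh.const_mul _).add (hg.const_mul _)).sub_const _
  have hΦ' : HasDerivAt Φ 0 z₀ := by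
    rw [← hcrit]
    exact ((hhd.const_mul _).add (hgd.const_mul _)).sub_const _
  have hre : ∀ z, (starRingEnd ℂ ε * harmonicSum h g z).re = (Ψ z).re := by
    intro z; simp [harmonicSum, Ψ]; ring
  have hcont : ContinuousOn (harmonicSum h g) U :=
    hh.continuousOn.add (Complex.continuous_conj.comp_continuousOn hg.continuousOn)
  obtain ⟨z₁, hz₁, z₂, hz₂, hne, h1, h2, hy⟩ := exists_ne_map_eq_of_deriv_eq_zero
    (hΦd.analyticAt (hU.mem_nhds hz₀)) (by simp [Φ]) hΦ'.deriv (hU.mem_nhds hz₀)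
    (y := fun z => (starRingEnd ℂ ε * harmonicSum h g z).im)
    (Complex.continuous_im.comp_continuousOn (continuousOn_const.mul hcont))
  refine hne (hinj hz₁ hz₂ ?_)
  have h3 : starRingEnd ℂ ε * harmonicSum h g z₁ = starRingEnd ℂ ε * harmonicSum h g z₂ := by
    refine Complex.ext ?_ hy
    rw [hre, hre]
    simp only [Φ, sub_re] at h1 h2
    linarith
  refine mul_left_cancel₀ ?_ h3
  intro h
  rw [h, zero_mul] at hεε
  exact zero_ne_one hεε

/-! ### Harmonic automorphisms of the disc: Jacobian and properness -/

theorem InnerProductSpace.HarmonicOnNhd.exists_eqOn_harmonicSum {f : ℂ → ℂ}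
    (hf : InnerProductSpace.HarmonicOnNhd f (ball (0 : ℂ) 1)) :
    ∃ h g : ℂ → ℂ, DifferentiableOn ℂ h (ball 0 1) ∧ DifferentiableOn ℂ g (ball 0 1) ∧ g 0 = 0 ∧
      EqOn f (harmonicSum h g) (ball 0 1) := by
  obtain ⟨A, hA, hAf⟩ := (hf.comp_CLM reCLM).exists_analyticOnNhd_ball_re_eq
  obtain ⟨B, hB, hBf⟩ := (hf.comp_CLM imCLM).exists_analyticOnNhd_ball_re_eq
  let h₀ : ℂ → ℂ := fun z => ((1 / 2 : ℝ) : ℂ) * (A z + I * B z)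
  let g₀ : ℂ → ℂ := fun z => ((1 / 2 : ℝ) : ℂ) * (A z - I * B z)
  have hh : DifferentiableOn ℂ h₀ (ball 0 1) :=
    (hA.differentiableOn.add (hB.differentiableOn.const_mul I)).const_mul _
  have hg : DifferentiableOn ℂ g₀ (ball 0 1) :=
    (hA.differentiableOn.sub (hB.differentiableOn.const_mul I)).const_mul _
  refine ⟨fun z => h₀ z + starRingEnd ℂ (g₀ 0), fun z => g₀ z - g₀ 0, hh.add_const _,
    hg.sub_const _, sub_self _, fun z hz => ?_⟩
  have h1 : (A z).re = (f z).re := hAf hz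
  have h2 : (B z).re = (f z).im := hBf hz
  simp only [harmonicSum, map_sub, map_mul, conj_ofReal, h₀, g₀]
  apply Complex.ext
  · simp only [add_re, sub_re, ofReal_re, ofReal_im, conj_re, mul_re, I_re, I_im,
      conj_I, neg_re, neg_im, conj_im]
    linarith
  · simp only [add_im, sub_im, add_re, sub_re, mul_re, ofReal_re, ofReal_im, conj_re, mul_im,
      I_re, I_im, conj_I, neg_re, neg_im, conj_im]
    linarith

/-- The real-linear map `w ↦ a w + conj (b w)`, the differential of a planar harmonic map. -/
noncomputable def wirtingerCLM (a b : ℂ) : ℂ →L[ℝ] ℂ :=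
  a • (1 : ℂ →L[ℝ] ℂ) + (starRingEnd ℂ b) • (conjCLE : ℂ →L[ℝ] ℂ)

theorem wirtingerCLM_apply (a b w : ℂ) :
    wirtingerCLM a b w = a * w + starRingEnd ℂ (b * w) := by
  simp [wirtingerCLM]

theorem det_wirtingerCLM (a b : ℂ) : (wirtingerCLM a b).det = ‖a‖ ^ 2 - ‖b‖ ^ 2 := by
  rw [ContinuousLinearMap.det, ← LinearMap.det_toMatrix basisOneI, Matrix.det_fin_two]
  simp only [LinearMap.toMatrix_apply, coe_basisOneI, ContinuousLinearMap.coe_coe,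
    wirtingerCLM_apply, coe_basisOneI_repr]
  simp only [← normSq_eq_norm_sq, normSq_apply]
  simp
  ring

theorem hasStrictFDerivAt_harmonicSum {h g : ℂ → ℂ} {U : Set ℂ} (hU : IsOpen U)
    (hh : DifferentiableOn ℂ h U) (hg : DifferentiableOn ℂ g U) {z : ℂ} (hz : z ∈ U) :
    HasStrictFDerivAt (harmonicSum h g) (wirtingerCLM (deriv h z) (deriv g z)) z := by
  have h1 := (hh.analyticAt (hU.mem_nhds hz)).hasStrictDerivAt.hasStrictFDerivAt.restrictScalars ℝ
  have h2 := (hg.analyticAt (hU.mem_nhds hz)).hasStrictDerivAt.hasStrictFDerivAt.restrictScalars ℝ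
  have h3 := h1.add ((conjCLE : ℂ →L[ℝ] ℂ).hasStrictFDerivAt.comp z h2)
  refine h3.congr_fderiv ?_
  ext; simp [wirtingerCLM_apply, mul_comm]

/-- The pair `(h, g)` represents a sense-preserving bijective harmonic map `h + conj g` of the
unit disc onto itself; the normalization `g 0 = 0` makes the pair unique. -/
structure IsHarmonicDiscAut (h g : ℂ → ℂ) : Prop where
  diff_left : DifferentiableOn ℂ h (ball 0 1)
  diff_right : DifferentiableOn ℂ g (ball 0 1)
  right_zero : g 0 = 0
  bijOn : BijOn (harmonicSum h g) (ball 0 1) (ball 0 1)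
  norm_deriv_lt : ∀ z ∈ ball (0 : ℂ) 1, ‖deriv g z‖ < ‖deriv h z‖

/-- The Jacobian of a bijective harmonic map of the disc has constant sign. -/
theorem norm_deriv_lt_or_gt_of_injOn {h g : ℂ → ℂ}
    (hh : DifferentiableOn ℂ h (ball 0 1)) (hg : DifferentiableOn ℂ g (ball 0 1))
    (hinj : InjOn (harmonicSum h g) (ball 0 1)) :
    (∀ z ∈ ball (0 : ℂ) 1, ‖deriv g z‖ < ‖deriv h z‖) ∨
      (∀ z ∈ ball (0 : ℂ) 1, ‖deriv h z‖ < ‖deriv g z‖) := by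
  have hc : ContinuousOn (fun z => ‖deriv h z‖ - ‖deriv g z‖) (ball 0 1) :=
    (hh.deriv isOpen_ball).continuousOn.norm.sub (hg.deriv isOpen_ball).continuousOn.norm
  have hpre : IsPreconnected (ball (0 : ℂ) 1) := (convex_ball 0 1).isPreconnected
  by_contra! hcon
  obtain ⟨⟨z, hz, hz'⟩, w, hw, hw'⟩ := hcon
  obtain ⟨p, hp, hp'⟩ := hpre.intermediate_value hz hw hc
    (show (0 : ℝ) ∈ Icc _ _ from ⟨sub_nonpos.2 hz', sub_nonneg.2 hw'⟩)
  exact norm_deriv_ne_of_injOn isOpen_ball hh hg hinj hp (sub_eq_zero.1 hp').symm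

namespace IsHarmonicDiscAut

variable {h g : ℂ → ℂ}

theorem continuousOn (H : IsHarmonicDiscAut h g) : ContinuousOn (harmonicSum h g) (ball 0 1) :=
  H.diff_left.continuousOn.add (Complex.continuous_conj.comp_continuousOn H.diff_right.continuousOn)

theorem hasStrictFDerivAt (H : IsHarmonicDiscAut h g) {z : ℂ} (hz : z ∈ ball (0 : ℂ) 1) :
    HasStrictFDerivAt (harmonicSum h g) (wirtingerCLM (deriv h z) (deriv g z)) z :=
  hasStrictFDerivAt_harmonicSum isOpen_ball H.diff_left H.diff_right hz

theorem norm_lt_one (H : IsHarmonicDiscAut h g) {z : ℂ} (hz : ‖z‖ < 1) :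
    ‖harmonicSum h g z‖ < 1 := by
  simpa using H.bijOn.mapsTo (show z ∈ ball (0 : ℂ) 1 by simpa using hz)

theorem jacobian_pos (H : IsHarmonicDiscAut h g) {z : ℂ} (hz : z ∈ ball (0 : ℂ) 1) :
    0 < ‖deriv h z‖ ^ 2 - ‖deriv g z‖ ^ 2 := by
  have := H.norm_deriv_lt z hz
  nlinarith [norm_nonneg (deriv g z)]

theorem map_nhds_eq (H : IsHarmonicDiscAut h g) {z : ℂ} (hz : z ∈ ball (0 : ℂ) 1) :
    map (harmonicSum h g) (𝓝 z) = 𝓝 (harmonicSum h g z) := by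
  have hdet : (wirtingerCLM (deriv h z) (deriv g z)).det ≠ 0 := by
    rw [det_wirtingerCLM]; exact (H.jacobian_pos hz).ne'
  have := H.hasStrictFDerivAt hz
  rw [← ContinuousLinearMap.coe_toContinuousLinearEquivOfDetNeZero _ hdet] at this
  exact this.map_nhds_eq_of_equiv

/-- A harmonic automorphism of the disc is proper: `|f(z)| → 1` as `|z| → 1`. Indeed its inverse is
continuous, as `f` is a local homeomorphism, and so maps compact sets to compact sets. -/
theorem exists_norm_le_of_norm_le (H : IsHarmonicDiscAut h g) {ρ : ℝ} (hρ : ρ < 1) :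
    ∃ R < 1, ∀ z ∈ ball (0 : ℂ) 1, ‖harmonicSum h g z‖ ≤ ρ → ‖z‖ ≤ R := by
  set f := harmonicSum h g
  let F := Function.invFunOn f (ball (0 : ℂ) 1)
  have hF : ∀ z ∈ ball (0 : ℂ) 1, F (f z) = z := fun z hz => H.bijOn.injOn.leftInvOn_invFunOn hz
  have hsub : closedBall (0 : ℂ) ρ ⊆ ball 0 1 := closedBall_subset_ball hρ
  have hFm : ∀ w ∈ ball (0 : ℂ) 1, F w ∈ ball (0 : ℂ) 1 := fun w hw =>
    Function.invFunOn_mem (H.bijOn.surjOn hw)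
  have hFr : ∀ w ∈ ball (0 : ℂ) 1, f (F w) = w := fun w hw =>
    Function.invFunOn_eq (H.bijOn.surjOn hw)
  have hFc : ContinuousOn F (closedBall 0 ρ) := by
    intro w hw
    apply ContinuousAt.continuousWithinAt
    have hz := hFm w (hsub hw)
    intro V hV
    have h1 : f '' (V ∩ ball 0 1) ∈ 𝓝 w := by
      have := image_mem_map (m := f) (inter_mem hV (isOpen_ball.mem_nhds hz))
      rw [H.map_nhds_eq hz] at this
      exact (hFr w (hsub hw)) ▸ this
    refine mem_map.2 (mem_of_superset h1 ?_)
    rintro _ ⟨z, ⟨hzV, hzb⟩, rfl⟩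
    simpa [hF z hzb] using hzV
  obtain hempty | hne := (closedBall (0 : ℂ) ρ).eq_empty_or_nonempty
  · refine ⟨0, one_pos, fun z _ hzρ => ?_⟩
    have : f z ∈ closedBall (0 : ℂ) ρ := by simpa using hzρ
    rw [hempty] at this
    exact absurd this (notMem_empty _)
  obtain ⟨w, hw, hmax⟩ := (isCompact_closedBall (0 : ℂ) ρ).exists_isMaxOn hne hFc.norm
  refine ⟨‖F w‖, by simpa using hFm w (hsub hw), fun z hz hzρ => ?_⟩
  have h1 : f z ∈ closedBall (0 : ℂ) ρ := by simpa using hzρ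
  have h2 := hmax h1
  simpa [hF z hz] using h2

end IsHarmonicDiscAut

/-! ### Boundary values -/

theorem continuous_circleMap_comp {E : Type*} [TopologicalSpace E] {f : ℂ → E}
    (hf : ContinuousOn f (ball 0 1)) {R : ℝ} (h0 : 0 ≤ R) (hR : R < 1) :
    Continuous fun θ : ℝ => f (circleMap 0 R θ) :=
  hf.comp_continuous (continuous_circleMap 0 R) fun θ => by
    simpa [abs_of_nonneg h0] using hR

namespace IsHarmonicDiscAut

variable {h g : ℂ → ℂ}

/-- Since `|f| ≤ 1`, the variance of the values of `f` on a circle with respect to the Poisson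
kernel at `z` is at most `1 - |f(z)|²`. Bounding the kernel below on an arc gives a bound for
the mean square oscillation of `f` on that arc. -/
theorem integral_norm_sub_sq_mul_le (H : IsHarmonicDiscAut h g) {z : ℂ} {R : ℝ} (hz : ‖z‖ < R)
    (hR : R < 1) {a b K : ℝ} (hab : a ≤ b) (hba : b ≤ a + 2 * Real.pi)
    (hK : ∀ θ ∈ Icc a b, ‖circleMap 0 R θ - z‖ ≤ K) :
    (∫ θ in a..b, ‖harmonicSum h g (circleMap 0 R θ) - harmonicSum h g z‖ ^ 2) *
      (R ^ 2 - ‖z‖ ^ 2) ≤ 2 * Real.pi * (1 - ‖harmonicSum h g z‖ ^ 2) * K ^ 2 := by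
  have hR0 : 0 < R := (norm_nonneg z).trans_lt hz
  set f := harmonicSum h g
  set c := f z
  -- `u = Re G = 1 + |c|² - 2 Re (conj c * f)` is a harmonic majorant of `|f - c|²`
  let G : ℂ → ℂ := fun ζ => ((1 + ‖c‖ ^ 2 : ℝ) : ℂ) - 2 * (starRingEnd ℂ c * h ζ + c * g ζ)
  let u : ℂ → ℝ := fun ζ => (G ζ).re
  have hGd : DifferentiableOn ℂ G (ball 0 1) :=
    (((H.diff_left.const_mul _).add (H.diff_right.const_mul _)).const_mul 2).const_sub _
  have hsub : closedBall (0 : ℂ) R ⊆ ball 0 1 := closedBall_subset_ball hR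
  have hu : HarmonicOnNhd u (closedBall 0 R) := fun ζ hζ =>
    (hGd.analyticAt (isOpen_ball.mem_nhds (hsub hζ))).harmonicAt_re
  have hueq : ∀ ζ, u ζ = 1 + ‖c‖ ^ 2 - 2 * (starRingEnd ℂ c * f ζ).re := by
    intro ζ
    simp [u, G, f, harmonicSum]
    norm_cast
    ring
  have hnormsq : ∀ ζ, ‖f ζ - c‖ ^ 2 = ‖f ζ‖ ^ 2 + ‖c‖ ^ 2 - 2 * (starRingEnd ℂ c * f ζ).re := by
    intro ζ
    simp only [← normSq_eq_norm_sq, normSq_apply, sub_re, sub_im, mul_re, conj_re, conj_im]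
    ring
  have hle : ∀ ζ, ‖ζ‖ < 1 → ‖f ζ - c‖ ^ 2 ≤ u ζ := by
    intro ζ hζ
    rw [hueq, hnormsq]
    have := H.norm_lt_one hζ
    nlinarith [norm_nonneg (f ζ)]
  have huz : u z = 1 - ‖c‖ ^ 2 := by
    have h1 := hnormsq z
    rw [hueq]
    simp only [sub_self, norm_zero, c] at h1 ⊢
    linarith
  have hpoi := hu.circleAverage_poissonKernel_smul (w := z) (by simpa using hz)
  rw [huz, Real.circleAverage_eq_integral_add a] at hpoi
  let v : ℝ → ℝ := fun θ => poissonKernel 0 z (circleMap 0 R θ) * u (circleMap 0 R θ)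
  have hnorm : ∀ θ, ‖circleMap 0 R θ‖ = R := fun θ => by simp [abs_of_pos hR0]
  have hpos : ∀ θ, 0 < ‖circleMap 0 R θ - z‖ := by
    intro θ
    have := norm_sub_norm_le (circleMap 0 R θ) z
    rw [hnorm] at this
    linarith
  have hv : ∀ θ, v θ = (R ^ 2 - ‖z‖ ^ 2) / ‖circleMap 0 R θ - z‖ ^ 2 * u (circleMap 0 R θ) := by
    intro θ; simp only [v, poissonKernel_def, sub_zero, hnorm]
  have hRz : 0 ≤ R ^ 2 - ‖z‖ ^ 2 := by nlinarith [norm_nonneg z]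
  have hu0 : ∀ θ, ‖f (circleMap 0 R θ) - c‖ ^ 2 ≤ u (circleMap 0 R θ) := fun θ =>
    hle _ (by rw [hnorm]; exact hR)
  have hv0 : ∀ θ, 0 ≤ v θ := by
    intro θ
    rw [hv]
    exact mul_nonneg (div_nonneg hRz (by positivity)) ((sq_nonneg _).trans (hu0 θ))
  have hvc : Continuous v := by
    have : v = fun θ => (R ^ 2 - ‖z‖ ^ 2) / ‖circleMap 0 R θ - z‖ ^ 2 * u (circleMap 0 R θ) :=
      funext hv
    rw [this]
    have huc : Continuous fun θ : ℝ => u (circleMap 0 R θ) :=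
      continuous_circleMap_comp (Complex.continuous_re.comp_continuousOn hGd.continuousOn) hR0.le hR
    exact (continuous_const.div (by fun_prop) fun θ => (pow_pos (hpos θ) 2).ne').mul huc
  have hfc : Continuous fun θ : ℝ => f (circleMap 0 R θ) :=
    continuous_circleMap_comp H.continuousOn hR0.le hR
  have htot : ∫ θ in a..(a + 2 * Real.pi), v θ = 2 * Real.pi * (1 - ‖c‖ ^ 2) := by
    rw [← hpoi, smul_eq_mul, ← mul_assoc, mul_inv_cancel₀ Real.two_pi_pos.ne', one_mul]
    have : (∫ θ in (0 : ℝ)..2 * Real.pi,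
        (poissonKernel 0 z • u) (circleMap 0 R (θ + a))) = ∫ θ in (0 : ℝ)..2 * Real.pi, v (θ + a) :=
      rfl
    rw [this, intervalIntegral.integral_comp_add_right (fun θ => v θ), zero_add, add_comm]
  calc (∫ θ in a..b, ‖f (circleMap 0 R θ) - c‖ ^ 2) * (R ^ 2 - ‖z‖ ^ 2)
      = ∫ θ in a..b, ‖f (circleMap 0 R θ) - c‖ ^ 2 * (R ^ 2 - ‖z‖ ^ 2) :=
        (intervalIntegral.integral_mul_const _ _).symm
    _ ≤ ∫ θ in a..b, v θ * K ^ 2 := by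
        refine intervalIntegral.integral_mono_on hab ?_ ?_ fun θ hθ => ?_
        · exact (((hfc.sub continuous_const).norm.pow 2).mul continuous_const).intervalIntegrable _ _
        · exact (hvc.mul continuous_const).intervalIntegrable _ _
        · have h1 : ‖circleMap 0 R θ - z‖ ^ 2 ≤ K ^ 2 :=
            pow_le_pow_left₀ (norm_nonneg _) (hK θ hθ) 2
          have h2 : v θ * ‖circleMap 0 R θ - z‖ ^ 2 = (R ^ 2 - ‖z‖ ^ 2) * u (circleMap 0 R θ) := by
            rw [hv]
            have := (hpos θ).ne'
            field_simp
          calc _ ≤ u (circleMap 0 R θ) * (R ^ 2 - ‖z‖ ^ 2) :=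
                mul_le_mul_of_nonneg_right (hu0 θ) hRz
            _ = v θ * ‖circleMap 0 R θ - z‖ ^ 2 := by rw [h2, mul_comm]
            _ ≤ _ := mul_le_mul_of_nonneg_left h1 (hv0 θ)
    _ = (∫ θ in a..b, v θ) * K ^ 2 := intervalIntegral.integral_mul_const _ _
    _ ≤ (∫ θ in a..(a + 2 * Real.pi), v θ) * K ^ 2 := by
        refine mul_le_mul_of_nonneg_right ?_ (sq_nonneg K)
        exact intervalIntegral.integral_mono_interval le_rfl hab hba
          (Eventually.of_forall hv0) (hvc.intervalIntegrable _ _)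
    _ = _ := by rw [htot]

end IsHarmonicDiscAut

/-- The point of the segment from `q` to the boundary point `e^{it}` of the unit disc with
parameter `ρ`. For `|q| < 1` these are star coordinates on the disc, centred at `q`. -/
noncomputable def starPoint (q : ℂ) (ρ t : ℝ) : ℂ := q + ρ * (circleMap 0 1 t - q)

theorem norm_circleMap_one (t : ℝ) : ‖circleMap 0 1 t‖ = 1 := by simp

theorem norm_starPoint_le (q : ℂ) {ρ : ℝ} (h0 : 0 ≤ ρ) (h1 : ρ ≤ 1) (t : ℝ) :
    ‖starPoint q ρ t‖ ≤ 1 - (1 - ρ) * (1 - ‖q‖) := by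
  have : starPoint q ρ t = ((1 - ρ : ℝ) : ℂ) * q + (ρ : ℂ) * circleMap 0 1 t := by
    simp only [starPoint]; push_cast; ring
  rw [this]
  refine (norm_add_le _ _).trans ?_
  rw [norm_mul, norm_mul, norm_circleMap_one, norm_real, norm_real, Real.norm_eq_abs,
    Real.norm_eq_abs, abs_of_nonneg h0, abs_of_nonneg (by linarith)]
  linarith

theorem norm_starPoint_lt_one {q : ℂ} (hq : ‖q‖ < 1) {ρ : ℝ} (h0 : 0 ≤ ρ) (h1 : ρ < 1) (t : ℝ) :
    ‖starPoint q ρ t‖ < 1 := by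
  have := norm_starPoint_le q h0 h1.le t
  nlinarith

theorem norm_circleMap_sub_starPoint_le {q : ℂ} (hq : ‖q‖ ≤ 1) {ρ : ℝ} (h1 : ρ ≤ 1) (t : ℝ) :
    ‖circleMap 0 1 t - starPoint q ρ t‖ ≤ 2 * (1 - ρ) := by
  have : circleMap 0 1 t - starPoint q ρ t = ((1 - ρ : ℝ) : ℂ) * (circleMap 0 1 t - q) := by
    simp only [starPoint]; push_cast; ring
  rw [this, norm_mul, norm_real, Real.norm_eq_abs, abs_of_nonneg (by linarith)]
  have h2 : ‖circleMap 0 1 t - q‖ ≤ 2 := by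
    have := norm_sub_le (circleMap 0 1 t) q
    rw [norm_circleMap_one] at this
    linarith
  nlinarith

theorem le_norm_starPoint {q : ℂ} (hq : ‖q‖ ≤ 1) {ρ : ℝ} (h1 : ρ ≤ 1) (t : ℝ) :
    1 - 2 * (1 - ρ) ≤ ‖starPoint q ρ t‖ := by
  have h2 := norm_circleMap_sub_starPoint_le hq h1 t
  have h3 := norm_sub_norm_le (circleMap 0 1 t) (starPoint q ρ t)
  rw [norm_circleMap_one] at h3
  linarith

theorem norm_circleMap_sub_circleMap_le (s t : ℝ) :
    ‖circleMap 0 1 s - circleMap 0 1 t‖ ≤ |s - t| := by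
  simpa [dist_eq_norm] using (lipschitzWith_circleMap 0 1).dist_le_mul s t

theorem norm_circleMap_sub_circleMap_one {R : ℝ} (hR : R ≤ 1) (t : ℝ) :
    ‖circleMap 0 R t - circleMap 0 1 t‖ = 1 - R := by
  have : circleMap 0 R t - circleMap 0 1 t = ((R - 1 : ℝ) : ℂ) * circleMap 0 1 t := by
    simp [circleMap]; ring
  rw [this, norm_mul, norm_circleMap_one, norm_real, Real.norm_eq_abs, abs_of_nonpos (by linarith)]
  ring

namespace IsHarmonicDiscAut

variable {h g : ℂ → ℂ}

theorem exists_lt_norm_starPoint (H : IsHarmonicDiscAut h g) {q : ℂ} (hq : ‖q‖ < 1) {M : ℝ}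
    (hM : M < 1) :
    ∃ ρ₀ < 1, 0 < ρ₀ ∧ ∀ ρ, ρ₀ < ρ → ρ < 1 → ∀ t, M < ‖harmonicSum h g (starPoint q ρ t)‖ := by
  obtain ⟨R, hR, hRz⟩ := H.exists_norm_le_of_norm_le hM
  refine ⟨max (1 / 2) ((1 + R) / 2), max_lt (by norm_num) (by linarith), by positivity, ?_⟩
  intro ρ hρ hρ1 t
  have h1 : (1 + R) / 2 < ρ := (le_max_right _ _).trans_lt hρ
  have h0 : 1 / 2 < ρ := (le_max_left _ _).trans_lt hρ
  by_contra! hle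
  have h2 := hRz _ (by simpa using norm_starPoint_lt_one hq (by linarith) hρ1 t) hle
  have h3 := le_norm_starPoint hq.le hρ1.le t
  linarith

theorem tendsto_norm_starPoint (H : IsHarmonicDiscAut h g) {q : ℂ} (hq : ‖q‖ < 1) (t : ℝ) :
    Tendsto (fun ρ => ‖harmonicSum h g (starPoint q ρ t)‖) (𝓝[<] 1) (𝓝 1) := by
  rw [tendsto_order]
  constructor
  · intro M hM
    obtain ⟨ρ₀, hρ₀, -, h1⟩ := H.exists_lt_norm_starPoint hq hM
    filter_upwards [Ioo_mem_nhdsLT hρ₀] with ρ hρ using h1 ρ hρ.1 hρ.2 t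
  · intro M hM
    filter_upwards [Ioo_mem_nhdsLT (zero_lt_one' ℝ)] with ρ hρ
    exact (H.norm_lt_one (norm_starPoint_lt_one hq hρ.1.le hρ.2 t)).trans hM

/-- The primitives of the boundary values on circles of radius `R` accumulate, as `R → 1`, at a
Lipschitz function `G`, and `f` at a point of a Stolz angle at `e^{it}` is close to a difference
quotient of `G` at `t`. The Lipschitz function is obtained as a limit along an ultrafilter. -/
theorem exists_lipschitz_primitive (H : IsHarmonicDiscAut h g) :
    ∃ G : ℝ → ℂ, LipschitzWith 1 G ∧ ∀ (q : ℂ) (ρ t δ : ℝ), ‖q‖ < 1 → 0 < ρ → ρ < 1 → 0 < δ →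
      ‖G (t + (1 - ρ)) - G t - ((1 - ρ : ℝ) : ℂ) * harmonicSum h g (starPoint q ρ t)‖ ≤
        (1 - ρ) * (δ / 2 + 9 * Real.pi / (δ * (1 - ‖q‖)) *
          (1 - ‖harmonicSum h g (starPoint q ρ t)‖ ^ 2)) := by
  set f := harmonicSum h g
  let 𝒰 : Ultrafilter ℝ := Ultrafilter.of (𝓝[<] (1 : ℝ))
  have h𝒰 : (𝒰 : Filter ℝ) ≤ 𝓝[<] (1 : ℝ) := Ultrafilter.of_le _
  let GR : ℝ → ℝ → ℂ := fun R t => ∫ θ in (0 : ℝ)..t, f (circleMap 0 R θ)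
  have hfc : ∀ R ∈ Ioo (0 : ℝ) 1, Continuous fun θ : ℝ => f (circleMap 0 R θ) := fun R hR =>
    continuous_circleMap_comp H.continuousOn hR.1.le hR.2
  have hf1 : ∀ R ∈ Ioo (0 : ℝ) 1, ∀ θ, ‖f (circleMap 0 R θ)‖ ≤ 1 := fun R hR θ =>
    (H.norm_lt_one (by simpa [abs_of_pos hR.1] using hR.2)).le
  have hIoo : ∀ᶠ R in (𝒰 : Filter ℝ), R ∈ Ioo (0 : ℝ) 1 := h𝒰 (Ioo_mem_nhdsLT zero_lt_one)
  have hsub : ∀ R ∈ Ioo (0 : ℝ) 1, ∀ s t, GR R t - GR R s = ∫ θ in s..t, f (circleMap 0 R θ) :=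
    fun R hR s t => intervalIntegral.integral_interval_sub_left
      ((hfc R hR).intervalIntegrable _ _) ((hfc R hR).intervalIntegrable _ _)
  have hlip : ∀ R ∈ Ioo (0 : ℝ) 1, ∀ s t, ‖GR R t - GR R s‖ ≤ |t - s| := by
    intro R hR s t
    rw [hsub R hR]
    simpa using intervalIntegral.norm_integral_le_of_norm_le_const (a := s) (b := t) (C := 1)
      (f := fun θ => f (circleMap 0 R θ)) fun θ _ => hf1 R hR θ
  have hlim : ∀ t, ∃ w, Tendsto (fun R => GR R t) 𝒰 (𝓝 w) := by
    intro t
    have hmem : (𝒰.map fun R => GR R t : Filter ℂ) ≤ 𝓟 (closedBall 0 |t|) := by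
      rw [le_principal_iff]
      change ∀ᶠ R in (𝒰 : Filter ℝ), GR R t ∈ closedBall (0 : ℂ) |t|
      filter_upwards [hIoo] with R hR
      have := hlip R hR 0 t
      simpa [GR] using this
    obtain ⟨w, -, hw⟩ := (isCompact_closedBall (0 : ℂ) |t|).ultrafilter_le_nhds _ hmem
    exact ⟨w, hw⟩
  choose G hG using hlim
  refine ⟨G, LipschitzWith.of_dist_le_mul fun t s => ?_, ?_⟩
  · rw [NNReal.coe_one, one_mul, dist_eq_norm, Real.dist_eq]
    refine le_of_tendsto ((hG t).sub (hG s)).norm ?_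
    filter_upwards [hIoo] with R hR using hlip R hR s t
  intro q ρ t δ hq hρ0 hρ1 hδ
  set z := starPoint q ρ t
  set c := f z
  have hz1 : ‖z‖ < 1 := norm_starPoint_lt_one hq hρ0.le hρ1 t
  have hc1 : ‖c‖ < 1 := H.norm_lt_one hz1
  have hη : 0 < 1 - ρ := by linarith
  have hzR : ∀ᶠ R in (𝒰 : Filter ℝ), ‖z‖ < R :=
    h𝒰 (mem_nhdsWithin_of_mem_nhds (lt_mem_nhds hz1))
  let B : ℝ → ℝ := fun R => (1 - ρ) * (δ / 2) + 1 / (2 * δ) *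
    (2 * Real.pi * (1 - ‖c‖ ^ 2) * (3 * (1 - ρ) + (1 - R)) ^ 2 / (R ^ 2 - ‖z‖ ^ 2))
  have hbound : ∀ᶠ R in (𝒰 : Filter ℝ),
      ‖GR R (t + (1 - ρ)) - GR R t - ((1 - ρ : ℝ) : ℂ) * c‖ ≤ B R := by
    filter_upwards [hIoo, hzR] with R hR hzR
    have hK : ∀ θ ∈ Icc t (t + (1 - ρ)),
        ‖circleMap 0 R θ - z‖ ≤ 3 * (1 - ρ) + (1 - R) := by
      intro θ hθ
      have e1 := norm_circleMap_sub_circleMap_one hR.2.le θ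
      have e2 := norm_circleMap_sub_circleMap_le θ t
      rw [abs_of_nonneg (by linarith [hθ.1])] at e2
      have e3 : ‖circleMap 0 1 t - z‖ ≤ 2 * (1 - ρ) :=
        norm_circleMap_sub_starPoint_le hq.le hρ1.le t
      have e4 := norm_add₃_le (a := circleMap 0 R θ - circleMap 0 1 θ)
        (b := circleMap 0 1 θ - circleMap 0 1 t) (c := circleMap 0 1 t - z)
      have e5 : circleMap 0 R θ - circleMap 0 1 θ + (circleMap 0 1 θ - circleMap 0 1 t) +
        (circleMap 0 1 t - z) = circleMap 0 R θ - z := by ring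
      rw [e5] at e4
      linarith [hθ.2]
    have hle : t ≤ t + (1 - ρ) := by linarith
    have hvar := H.integral_norm_sub_sq_mul_le hzR hR.2 hle
      (by linarith [Real.pi_gt_three]) hK
    have hRz : 0 < R ^ 2 - ‖z‖ ^ 2 := by nlinarith [norm_nonneg z]
    rw [← le_div_iff₀ hRz] at hvar
    have hc' : Continuous fun θ : ℝ => f (circleMap 0 R θ) - c := (hfc R hR).sub continuous_const
    have hc'' : Continuous fun θ : ℝ => 1 / (2 * δ) * ‖f (circleMap 0 R θ) - c‖ ^ 2 :=
      continuous_const.mul (hc'.norm.pow 2)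
    rw [hsub R hR]
    have e6 : (∫ θ in t..(t + (1 - ρ)), f (circleMap 0 R θ)) - ((1 - ρ : ℝ) : ℂ) * c =
        ∫ θ in t..(t + (1 - ρ)), (f (circleMap 0 R θ) - c) := by
      rw [intervalIntegral.integral_sub ((hfc R hR).intervalIntegrable _ _)
        (continuous_const.intervalIntegrable _ _), intervalIntegral.integral_const]
      simp
    rw [e6]
    calc _ ≤ ∫ θ in t..(t + (1 - ρ)), ‖f (circleMap 0 R θ) - c‖ :=
          intervalIntegral.norm_integral_le_integral_norm hle
      _ ≤ ∫ θ in t..(t + (1 - ρ)), (δ / 2 + 1 / (2 * δ) * ‖f (circleMap 0 R θ) - c‖ ^ 2) := by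
          refine intervalIntegral.integral_mono hle (hc'.norm.intervalIntegrable _ _)
            ((continuous_const.add hc'').intervalIntegrable _ _)
            fun θ => ?_
          -- the elementary inequality `x ≤ δ / 2 + x² / (2 δ)`
          have : 0 ≤ (‖f (circleMap 0 R θ) - c‖ - δ) ^ 2 / (2 * δ) := by positivity
          have e7 : (‖f (circleMap 0 R θ) - c‖ - δ) ^ 2 / (2 * δ) = δ / 2 +
            1 / (2 * δ) * ‖f (circleMap 0 R θ) - c‖ ^ 2 - ‖f (circleMap 0 R θ) - c‖ := by
            field_simp; ring
          simp only
          linarith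
      _ = (1 - ρ) * (δ / 2) + 1 / (2 * δ) *
            ∫ θ in t..(t + (1 - ρ)), ‖f (circleMap 0 R θ) - c‖ ^ 2 := by
          rw [intervalIntegral.integral_add (continuous_const.intervalIntegrable _ _)
            (hc''.intervalIntegrable _ _),
            intervalIntegral.integral_const, intervalIntegral.integral_const_mul]
          simp
      _ ≤ B R := by
          refine add_le_add le_rfl (mul_le_mul_of_nonneg_left hvar (by positivity))
  have hz2 : 0 < 1 ^ 2 - ‖z‖ ^ 2 := by nlinarith [norm_nonneg z]
  have hBlim : Tendsto B 𝒰 (𝓝 (B 1)) := by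
    have : ContinuousAt B 1 := by
      refine ContinuousAt.add continuousAt_const (ContinuousAt.mul continuousAt_const ?_)
      exact ContinuousAt.div (by fun_prop) (by fun_prop) hz2.ne'
    exact this.tendsto.mono_left (h𝒰.trans nhdsWithin_le_nhds)
  have hfin := le_of_tendsto_of_tendsto (((hG (t + (1 - ρ))).sub (hG t)).sub_const _).norm hBlim
    hbound
  refine hfin.trans ?_
  have hz3 : (1 - ρ) * (1 - ‖q‖) ≤ 1 ^ 2 - ‖z‖ ^ 2 := by
    have := norm_starPoint_le q hρ0.le hρ1.le t
    have h2 : ‖z‖ ≤ 1 - (1 - ρ) * (1 - ‖q‖) := this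
    nlinarith [norm_nonneg z]
  have hq' : 0 < 1 - ‖q‖ := by linarith
  have hc2 : 0 ≤ 1 - ‖c‖ ^ 2 := by nlinarith [norm_nonneg c]
  have hpi := Real.pi_pos
  calc B 1 = (1 - ρ) * (δ / 2) + 1 / (2 * δ) *
      (2 * Real.pi * (1 - ‖c‖ ^ 2) * (9 * (1 - ρ) ^ 2) / (1 ^ 2 - ‖z‖ ^ 2)) := by
        simp only [B]; ring
    _ ≤ (1 - ρ) * (δ / 2) + 1 / (2 * δ) *
      (2 * Real.pi * (1 - ‖c‖ ^ 2) * (9 * (1 - ρ) ^ 2) / ((1 - ρ) * (1 - ‖q‖))) := by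
        gcongr
    _ = _ := by
        field_simp

/-- Fatou's theorem for harmonic automorphisms of the disc: at almost every boundary point, `f` has
a limit, the same along every segment ending there. The limit is the derivative of the Lipschitz
primitive; the error term of `exists_lipschitz_primitive` vanishes since `|f| → 1`. -/
theorem ae_exists_tendsto_starPoint (H : IsHarmonicDiscAut h g) :
    ∀ᵐ t : ℝ, ∃ F : ℂ, ∀ q : ℂ, ‖q‖ < 1 →
      Tendsto (fun ρ => harmonicSum h g (starPoint q ρ t)) (𝓝[<] 1) (𝓝 F) := by
  obtain ⟨G, hG, hest⟩ := H.exists_lipschitz_primitive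
  filter_upwards [hG.ae_differentiableAt_real] with t ht
  refine ⟨deriv G t, fun q hq => ?_⟩
  set f := harmonicSum h g
  have hη : Tendsto (fun ρ : ℝ => 1 - ρ) (𝓝[<] 1) (𝓝[>] 0) := by
    refine tendsto_nhdsWithin_iff.2 ⟨?_, ?_⟩
    · have : Tendsto (fun ρ : ℝ => 1 - ρ) (𝓝 1) (𝓝 (1 - 1)) := by
        apply Continuous.tendsto; fun_prop
      rw [sub_self] at this
      exact this.mono_left nhdsWithin_le_nhds
    · filter_upwards [self_mem_nhdsWithin] with ρ hρ
      simpa using hρ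
  have hslope : Tendsto (fun ρ : ℝ => (1 - ρ)⁻¹ • (G (t + (1 - ρ)) - G t)) (𝓝[<] 1)
      (𝓝 (deriv G t)) :=
    (hasDerivAt_iff_tendsto_slope_zero.1 ht.hasDerivAt).comp
      (hη.mono_right (nhdsWithin_mono _ fun x (hx : 0 < x) => hx.ne'))
  have hdiff : Tendsto (fun ρ : ℝ => (1 - ρ)⁻¹ • (G (t + (1 - ρ)) - G t) -
      f (starPoint q ρ t)) (𝓝[<] 1) (𝓝 0) := by
    rw [Metric.tendsto_nhds]
    intro δ hδ
    have hn : Tendsto (fun ρ => δ / 2 + 9 * Real.pi / (δ * (1 - ‖q‖)) *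
        (1 - ‖f (starPoint q ρ t)‖ ^ 2)) (𝓝[<] 1) (𝓝 (δ / 2 + 9 * Real.pi / (δ * (1 - ‖q‖)) *
        (1 - 1 ^ 2))) :=
      (((H.tendsto_norm_starPoint hq t).pow 2).const_sub 1).const_mul _ |>.const_add _
    have hlt : δ / 2 + 9 * Real.pi / (δ * (1 - ‖q‖)) * (1 - 1 ^ 2) < δ := by
      norm_num; exact hδ
    filter_upwards [hn.eventually (gt_mem_nhds hlt), Ioo_mem_nhdsLT (zero_lt_one' ℝ)] with ρ h1 hρ
    have hρ' : 0 < 1 - ρ := by linarith [hρ.2]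
    rw [dist_zero_right]
    refine lt_of_le_of_lt ?_ h1
    have h2 := hest q ρ t δ hq hρ.1 hρ.2 hδ
    have h3 : (1 - ρ)⁻¹ • (G (t + (1 - ρ)) - G t) - f (starPoint q ρ t) =
        (1 - ρ)⁻¹ • (G (t + (1 - ρ)) - G t - ((1 - ρ : ℝ) : ℂ) * f (starPoint q ρ t)) := by
      rw [smul_sub _ (_ - _), ← real_smul, smul_smul, inv_mul_cancel₀ hρ'.ne', one_smul]
    rw [h3, norm_smul, Real.norm_eq_abs, abs_of_pos (inv_pos.2 hρ'), inv_mul_le_iff₀ hρ']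
    exact h2
  have := hslope.sub hdiff
  simpa using this

end IsHarmonicDiscAut

/-! ### Monotonicity of the boundary correspondence -/

theorem starPoint_add_two_pi (q : ℂ) (ρ t : ℝ) :
    starPoint q ρ (t + 2 * Real.pi) = starPoint q ρ t := by
  simp only [starPoint, periodic_circleMap 0 1 t]

theorem continuous_starPoint (q : ℂ) : Continuous fun p : ℝ × ℝ => starPoint q p.1 p.2 := by
  unfold starPoint circleMap
  fun_prop

/-- Star coordinates on the punctured disc are injective. -/
theorem starPoint_inj {q : ℂ} (hq : ‖q‖ < 1) {ρ ρ' t t' : ℝ} (hρ : 0 < ρ) (hρ' : 0 < ρ')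
    (h : starPoint q ρ t = starPoint q ρ' t') : ρ = ρ' ∧ circleMap 0 1 t = circleMap 0 1 t' := by
  have le : ∀ {ρ ρ' t t' : ℝ}, 0 < ρ → 0 < ρ' → starPoint q ρ t = starPoint q ρ' t' →
      ρ' ≤ ρ := by
    intro ρ ρ' t t' hρ hρ' h
    by_contra! hlt
    have h1 : (ρ' : ℂ) * circleMap 0 1 t' = ((ρ' - ρ : ℝ) : ℂ) * q + ρ * circleMap 0 1 t := by
      simp only [starPoint] at h
      push_cast
      linear_combination -h
    have h2 : ρ' ≤ (ρ' - ρ) * ‖q‖ + ρ := by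
      have h3 := congrArg (‖·‖) h1
      simp only [norm_mul, norm_circleMap_one, norm_real, Real.norm_eq_abs, abs_of_pos hρ',
        mul_one] at h3
      have h4 := norm_add_le (((ρ' - ρ : ℝ) : ℂ) * q) (ρ * circleMap 0 1 t)
      rw [norm_mul, norm_mul, norm_circleMap_one, norm_real, norm_real, Real.norm_eq_abs,
        Real.norm_eq_abs, abs_of_pos hρ, abs_of_pos (by linarith : 0 < ρ' - ρ)] at h4
      linarith
    nlinarith
  have heq : ρ = ρ' := le_antisymm (le hρ' hρ h.symm) (le hρ hρ' h)
  subst heq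
  refine ⟨rfl, ?_⟩
  have hρc : (ρ : ℂ) ≠ 0 := by exact_mod_cast hρ.ne'
  simp only [starPoint, add_right_inj] at h
  exact sub_left_inj.1 (mul_left_cancel₀ hρc h)

theorem starPoint_ne {q : ℂ} (hq : ‖q‖ < 1) {ρ : ℝ} (hρ : 0 < ρ) (t : ℝ) : starPoint q ρ t ≠ q := by
  have hρc : (ρ : ℂ) ≠ 0 := by exact_mod_cast hρ.ne'
  intro h
  have h1 : circleMap 0 1 t = q := by
    have : (ρ : ℂ) * (circleMap 0 1 t - q) = 0 := by
      simp only [starPoint] at h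
      linear_combination h
    exact sub_eq_zero.1 ((mul_eq_zero.1 this).resolve_left hρc)
  rw [← h1, norm_circleMap_one] at hq
  exact lt_irrefl _ hq

namespace IsHarmonicDiscAut

variable {h g : ℂ → ℂ}

theorem exists_zero (H : IsHarmonicDiscAut h g) : ∃ q, ‖q‖ < 1 ∧ harmonicSum h g q = 0 := by
  obtain ⟨q, hq, h0⟩ := H.bijOn.surjOn (mem_ball_self (x := (0 : ℂ)) one_pos)
  exact ⟨q, by simpa using hq, h0⟩

theorem harmonicSum_starPoint_ne_zero (H : IsHarmonicDiscAut h g) {q : ℂ} (hq : ‖q‖ < 1)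
    (h0 : harmonicSum h g q = 0) {ρ : ℝ} (hρ : ρ ∈ Ioo (0 : ℝ) 1) (t : ℝ) :
    harmonicSum h g (starPoint q ρ t) ≠ 0 := fun he =>
  starPoint_ne hq hρ.1 t (H.bijOn.injOn
    (by simpa using norm_starPoint_lt_one hq hρ.1.le hρ.2 t) (by simpa using hq) (he.trans h0.symm))

theorem continuousOn_harmonicSum_starPoint (H : IsHarmonicDiscAut h g) {q : ℂ} (hq : ‖q‖ < 1) :
    ContinuousOn (fun p : ℝ × ℝ => harmonicSum h g (starPoint q p.1 p.2)) (Ioo 0 1 ×ˢ univ) :=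
  H.continuousOn.comp (continuous_starPoint q).continuousOn fun p hp => by
    simpa using norm_starPoint_lt_one hq hp.1.1.le hp.1.2 p.2

/-- Near its zero `q` a sense-preserving harmonic map is close enough to its holomorphic linear
part for their quotient to stay in the right half-plane. -/
theorem exists_norm_div_sub_one_lt (H : IsHarmonicDiscAut h g) {q : ℂ} (hq : ‖q‖ < 1)
    (h0 : harmonicSum h g q = 0) :
    ∃ δ > 0, ∀ z, ‖z - q‖ < δ → z ≠ q →
      ‖harmonicSum h g z / (deriv h q * (z - q)) - 1‖ < 1 := by
  have hqb : q ∈ ball (0 : ℂ) 1 := by simpa using hq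
  have hab := H.norm_deriv_lt q hqb
  have ha : 0 < ‖deriv h q‖ := (norm_nonneg _).trans_lt hab
  have hε : 0 < (‖deriv h q‖ - ‖deriv g q‖) / 2 := by linarith
  have hd := (H.hasStrictFDerivAt hqb).hasFDerivAt.isLittleO.def hε
  obtain ⟨δ, hδ, hball⟩ := Metric.eventually_nhds_iff.1 hd
  refine ⟨δ, hδ, fun z hz hne => ?_⟩
  have h1 := hball (by simpa [dist_eq_norm] using hz : dist z q < δ)
  rw [h0, sub_zero, wirtingerCLM_apply] at h1
  have hzq : z - q ≠ 0 := sub_ne_zero.2 hne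
  have hzq' : 0 < ‖z - q‖ := norm_pos_iff.2 hzq
  have ha' : deriv h q ≠ 0 := norm_pos_iff.1 ha
  have h2 : harmonicSum h g z / (deriv h q * (z - q)) - 1 =
      (harmonicSum h g z - deriv h q * (z - q)) / (deriv h q * (z - q)) := by
    field_simp
  rw [h2, norm_div, norm_mul, div_lt_one (by positivity)]
  have h3 := norm_add_le (harmonicSum h g z - (deriv h q * (z - q) +
    starRingEnd ℂ (deriv g q * (z - q)))) (starRingEnd ℂ (deriv g q * (z - q)))
  rw [RCLike.norm_conj, norm_mul] at h3
  have h4 : harmonicSum h g z - (deriv h q * (z - q) +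
    starRingEnd ℂ (deriv g q * (z - q))) + starRingEnd ℂ (deriv g q * (z - q)) =
    harmonicSum h g z - deriv h q * (z - q) := by ring
  rw [h4] at h3
  nlinarith

/-- A continuous branch of `log f` in star coordinates about the zero `q` of `f`. It increases by
`2πi` around `q`, as `f` has degree one. -/
theorem exists_log_lift (H : IsHarmonicDiscAut h g) {q : ℂ} (hq : ‖q‖ < 1)
    (h0 : harmonicSum h g q = 0) :
    ∃ L : ℝ × ℝ → ℂ, ContinuousOn L (Ioo 0 1 ×ˢ univ) ∧
      (∀ ρ ∈ Ioo (0 : ℝ) 1, ∀ t, exp (L (ρ, t)) = harmonicSum h g (starPoint q ρ t)) ∧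
      ∀ ρ ∈ Ioo (0 : ℝ) 1, ∀ t, L (ρ, t + 2 * Real.pi) = L (ρ, t) + 2 * Real.pi * I := by
  set U : Set (ℝ × ℝ) := Ioo 0 1 ×ˢ univ
  set f := harmonicSum h g
  have hU : Convex ℝ U := (convex_Ioo 0 1).prod convex_univ
  have hUne : U.Nonempty := ⟨(1 / 2, 0), by norm_num, mem_univ _⟩
  obtain ⟨L, hLc, hL⟩ := Complex.exists_continuousOn_eqOn_exp_comp
    (hU.isSimplyConnected_of_nonempty hUne) (isOpen_Ioo.prod isOpen_univ)
    (H.continuousOn_harmonicSum_starPoint hq)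
    (by rintro ⟨p, hp, he⟩; exact H.harmonicSum_starPoint_ne_zero hq h0 hp.1 p.2 he)
  have hexp : ∀ ρ ∈ Ioo (0 : ℝ) 1, ∀ t, exp (L (ρ, t)) = f (starPoint q ρ t) :=
    fun ρ hρ t => hL (show (ρ, t) ∈ U from ⟨hρ, mem_univ _⟩)
  refine ⟨L, hLc, hexp, ?_⟩
  obtain ⟨n, hn⟩ := exists_int_eq_of_exp_eq_one hU.isPreconnected
    (φ := fun p => L (p.1, p.2 + 2 * Real.pi) - L p)
    ((hLc.comp (by fun_prop) fun p hp => ⟨hp.1, mem_univ _⟩).sub hLc) (by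
      rintro ⟨ρ, t⟩ hp
      simp only
      rw [Complex.exp_sub, hexp ρ hp.1, hexp ρ hp.1, starPoint_add_two_pi]
      exact div_self (H.harmonicSum_starPoint_ne_zero hq h0 hp.1 t))
  suffices hn1 : n = 1 by
    intro ρ hρ t
    have := hn (ρ, t) ⟨hρ, mem_univ _⟩
    simp only [hn1, Int.cast_one, one_mul] at this
    rw [← this]; ring
  -- the increment is computed on a small curve around `q`
  obtain ⟨δ, hδ, hW⟩ := H.exists_norm_div_sub_one_lt hq h0
  obtain ⟨ρ, hρ0, hρ⟩ := exists_between (lt_min (half_pos hδ) one_pos)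
  have hρδ : 2 * ρ < δ := by linarith [hρ.trans_le (min_le_left _ _)]
  have hρ1 : ρ ∈ Ioo (0 : ℝ) 1 := ⟨hρ0, hρ.trans_le (min_le_right _ _)⟩
  have hρc : (ρ : ℂ) ≠ 0 := by exact_mod_cast hρ0.ne'
  set a := deriv h q
  have ha : a ≠ 0 := norm_pos_iff.1
    ((norm_nonneg _).trans_lt (H.norm_deriv_lt q (by simpa using hq)))
  let W : ℝ → ℂ := fun t => f (starPoint q ρ t) / (a * (starPoint q ρ t - q))
  -- `f(z) = a ρ * e^{it} * N t * W t` with `N` and `W` in the slit plane, which gives an explicit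
  -- branch `ℓ` of the logarithm
  let N : ℝ → ℂ := fun t => 1 - q * circleMap 0 1 (-t)
  have hsub : ∀ t, starPoint q ρ t - q = ρ * (circleMap 0 1 t - q) := fun t => by
    simp [starPoint]
  have hW1 : ∀ t, W t ∈ slitPlane := by
    intro t
    have hlt : ‖starPoint q ρ t - q‖ < δ := by
      rw [hsub, norm_mul, norm_real, Real.norm_eq_abs, abs_of_pos hρ0]
      have := norm_sub_le (circleMap 0 1 t) q
      rw [norm_circleMap_one] at this
      nlinarith
    have := mem_slitPlane_of_norm_lt_one (hW _ hlt (starPoint_ne hq hρ0 t))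
    simpa using this
  have hN1 : ∀ t, N t ∈ slitPlane := by
    intro t
    have : ‖-(q * circleMap 0 1 (-t))‖ < 1 := by
      rw [norm_neg, norm_mul, norm_circleMap_one, mul_one]; exact hq
    simpa [N, sub_eq_add_neg] using mem_slitPlane_of_norm_lt_one this
  have hfc : Continuous fun t : ℝ => f (starPoint q ρ t) :=
    (H.continuousOn_harmonicSum_starPoint hq).comp_continuous
      (f := fun t : ℝ => ((ρ, t) : ℝ × ℝ)) (by fun_prop) fun t => ⟨hρ1, mem_univ _⟩
  have hsc : Continuous fun t : ℝ => starPoint q ρ t := by unfold starPoint; fun_prop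
  have hWc : Continuous W := hfc.div (continuous_const.mul (hsc.sub continuous_const)) fun t =>
    mul_ne_zero ha (sub_ne_zero.2 (starPoint_ne hq hρ0 t))
  have hNc : Continuous N := by simp only [N, circleMap]; fun_prop
  let ℓ : ℝ → ℂ := fun t => log (a * ρ) + t * I + log (N t) + log (W t)
  have hℓc : Continuous ℓ :=
    (((continuous_const.add (by fun_prop)).add (hNc.clog hN1)).add (hWc.clog hW1))
  have hLρ : Continuous fun t : ℝ => L (ρ, t) :=
    hLc.comp_continuous (f := fun t : ℝ => ((ρ, t) : ℝ × ℝ)) (by fun_prop)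
      fun t => ⟨hρ1, mem_univ _⟩
  have hℓexp : ∀ t, exp (ℓ t) = f (starPoint q ρ t) := by
    intro t
    have hz : starPoint q ρ t - q ≠ 0 := sub_ne_zero.2 (starPoint_ne hq hρ0 t)
    simp only [ℓ]
    rw [Complex.exp_add, Complex.exp_add, Complex.exp_add, exp_log (mul_ne_zero ha hρc),
      exp_log (slitPlane_ne_zero (hN1 t)), exp_log (slitPlane_ne_zero (hW1 t))]
    have e1 : exp (t * I) * N t = circleMap 0 1 t - q := by
      simp only [N, circleMap]
      have : exp (t * I) * exp (((-t : ℝ) : ℂ) * I) = 1 := by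
        rw [← Complex.exp_add]; simp
      push_cast at this ⊢
      linear_combination (-q) * this
    have e2 : a * ρ * exp (t * I) * N t = a * (starPoint q ρ t - q) := by
      rw [hsub, ← e1]; ring
    rw [e2, mul_div_cancel₀ _ (mul_ne_zero ha hz)]
  obtain ⟨m, hm⟩ := exists_int_eq_of_exp_eq_one (A := (univ : Set ℝ)) isPreconnected_univ
    (φ := fun t => L (ρ, t) - ℓ t) (hLρ.sub hℓc).continuousOn (by
      intro t _
      rw [Complex.exp_sub, hexp ρ hρ1, hℓexp]
      exact div_self (H.harmonicSum_starPoint_ne_zero hq h0 hρ1 t))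
  have hm0 := hm 0 (mem_univ _)
  have hm1 := hm (0 + 2 * Real.pi) (mem_univ _)
  have hℓper : ℓ (0 + 2 * Real.pi) = ℓ 0 + 2 * Real.pi * I := by
    have hNp : N (0 + 2 * Real.pi) = N 0 := by
      have := periodic_circleMap 0 1 (-(0 + 2 * Real.pi))
      simp only [N]
      rw [← this]
      congr 3
      ring
    have hWp : W (0 + 2 * Real.pi) = W 0 := by simp only [W, starPoint_add_two_pi]
    simp only [ℓ, hNp, hWp]
    push_cast
    ring
  have hn0 := hn (ρ, 0) ⟨hρ1, mem_univ _⟩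
  simp only at hn0 hm0 hm1
  have : (n : ℂ) * (2 * Real.pi * I) = 1 * (2 * Real.pi * I) := by
    rw [← hn0]
    linear_combination hm1 - hm0 + hℓper
  exact_mod_cast mul_right_cancel₀ Complex.two_pi_I_ne_zero this

end IsHarmonicDiscAut

namespace IsHarmonicDiscAut

variable {h g : ℂ → ℂ}

/-- The radial limits of the argument of `f` are increasing in the boundary point. If two of them
were in the wrong order, consider the difference of the values of `log f` at two points that
exchange their radii while one of them turns around the disc. By the Poincaré–Miranda theorem it
would have a zero, contrary to the injectivity of `f`. -/
theorem le_of_tendsto_im_log_lift (H : IsHarmonicDiscAut h g) {q : ℂ} (hq : ‖q‖ < 1)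
    {L : ℝ × ℝ → ℂ} (hLc : ContinuousOn L (Ioo 0 1 ×ˢ univ))
    (hexp : ∀ ρ ∈ Ioo (0 : ℝ) 1, ∀ t, exp (L (ρ, t)) = harmonicSum h g (starPoint q ρ t))
    (hper : ∀ ρ ∈ Ioo (0 : ℝ) 1, ∀ t, L (ρ, t + 2 * Real.pi) = L (ρ, t) + 2 * Real.pi * I)
    {t s x y : ℝ} (hts : t < s) (ht : Tendsto (fun ρ => (L (ρ, t)).im) (𝓝[<] 1) (𝓝 x))
    (hs : Tendsto (fun ρ => (L (ρ, s)).im) (𝓝[<] 1) (𝓝 y)) : x ≤ y := by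
  by_contra! hyx
  set f := harmonicSum h g
  have hpern : ∀ (n : ℕ), ∀ ρ ∈ Ioo (0 : ℝ) 1, ∀ t,
      L (ρ, t + n * (2 * Real.pi)) = L (ρ, t) + n * (2 * Real.pi * I) := by
    intro n
    induction n with
    | zero => intro ρ _ t; simp
    | succ n ih =>
      intro ρ hρ t
      have := hper ρ hρ (t + n * (2 * Real.pi))
      rw [ih ρ hρ] at this
      push_cast
      rw [show t + ((n : ℝ) + 1) * (2 * Real.pi) = t + n * (2 * Real.pi) + 2 * Real.pi by ring,
        this]
      ring
  obtain ⟨m, hym, hmx⟩ := exists_between hyx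
  -- beyond the radius `ρ₁` the arguments on the two segments are separated by `m`
  obtain ⟨ρ₁, hρ₁, hsep⟩ := (mem_nhdsLT_iff_exists_Ioo_subset).1
    (inter_mem (inter_mem (ht.eventually (lt_mem_nhds hmx)) (hs.eventually (gt_mem_nhds hym)))
      (Ioo_mem_nhdsLT (zero_lt_one' ℝ)))
  obtain ⟨ρ₂, hρ₁₂, hρ₂⟩ := exists_between (show ρ₁ < 1 from hρ₁)
  have hρ₂0 : 0 < ρ₂ := (hsep ⟨hρ₁₂, hρ₂⟩).2.1
  -- a radius `ρ₃` on which `|f|` exceeds its values on the radius `ρ₂`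
  obtain ⟨M, hM, hMle⟩ : ∃ M < 1, ∀ τ, ‖f (starPoint q ρ₂ τ)‖ ≤ M := by
    have hr : 1 - (1 - ρ₂) * (1 - ‖q‖) < 1 := by nlinarith
    have hsub : closedBall (0 : ℂ) (1 - (1 - ρ₂) * (1 - ‖q‖)) ⊆ ball 0 1 :=
      closedBall_subset_ball hr
    have hmem : ∀ τ, starPoint q ρ₂ τ ∈ closedBall (0 : ℂ) (1 - (1 - ρ₂) * (1 - ‖q‖)) := fun τ => by
      simpa using norm_starPoint_le q hρ₂0.le hρ₂.le τ
    obtain ⟨w, hw, hmax⟩ := (isCompact_closedBall (0 : ℂ) _).exists_isMaxOn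
      ⟨_, hmem 0⟩ (H.continuousOn.mono hsub).norm
    exact ⟨‖f w‖, H.norm_lt_one (by simpa using hsub hw), fun τ => hmax (hmem τ)⟩
  obtain ⟨ρ₀, hρ₀, -, hlt⟩ := H.exists_lt_norm_starPoint hq hM
  obtain ⟨ρ₃, hρ₃', hρ₃⟩ := exists_between (max_lt hρ₀ hρ₂)
  have hρ₂₃ : ρ₂ < ρ₃ := (le_max_right _ _).trans_lt hρ₃'
  have hmax : ∀ τ, M < ‖f (starPoint q ρ₃ τ)‖ := hlt ρ₃ ((le_max_left _ _).trans_lt hρ₃') hρ₃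
  have hIoo : ∀ r ∈ Icc ρ₂ ρ₃, r ∈ Ioo (0 : ℝ) 1 := fun r hr =>
    ⟨hρ₂0.trans_le hr.1, hr.2.trans_lt hρ₃⟩
  have hsepI : ∀ r ∈ Icc ρ₂ ρ₃, m < (L (r, t)).im ∧ (L (r, s)).im < m := fun r hr =>
    (hsep ⟨hρ₁₂.trans_le hr.1, hr.2.trans_lt hρ₃⟩).1
  have hre : ∀ r ∈ Ioo (0 : ℝ) 1, ∀ τ,
      Real.exp (L (r, τ)).re = ‖f (starPoint q r τ)‖ := fun r hr τ => by
    rw [← hexp r hr, norm_exp]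
  have hcmp : ∀ τ τ', (L (ρ₂, τ)).re < (L (ρ₃, τ')).re := by
    intro τ τ'
    rw [← Real.exp_lt_exp, hre _ (hIoo _ ⟨le_rfl, hρ₂₃.le⟩), hre _ (hIoo _ ⟨hρ₂₃.le, le_rfl⟩)]
    exact (hMle τ).trans_lt (hmax τ')
  let u : ℝ → ℝ := fun c => ρ₃ + c * (ρ₂ - ρ₃)
  let v : ℝ → ℝ := fun c => ρ₂ + c * (ρ₃ - ρ₂)
  have hu : ∀ c ∈ Icc (0 : ℝ) 1, u c ∈ Icc ρ₂ ρ₃ := fun c hc => by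
    constructor <;> simp only [u] <;> nlinarith [hc.1, hc.2]
  have hv : ∀ c ∈ Icc (0 : ℝ) 1, v c ∈ Icc ρ₂ ρ₃ := fun c hc => by
    constructor <;> simp only [v] <;> nlinarith [hc.1, hc.2]
  have hLu : ContinuousOn (fun p : ℝ × ℝ => L (u p.1, t)) (Icc 0 1 ×ˢ univ) :=
    hLc.comp (f := fun p : ℝ × ℝ => (u p.1, t)) (by fun_prop)
      fun p hp => ⟨hIoo _ (hu _ hp.1), mem_univ _⟩
  have hLv : ContinuousOn (fun p : ℝ × ℝ => L (v p.1, p.2)) (Icc 0 1 ×ˢ univ) :=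
    hLc.comp (f := fun p : ℝ × ℝ => (v p.1, p.2)) (by fun_prop)
      fun p hp => ⟨hIoo _ (hv _ hp.1), mem_univ _⟩
  have hDc : ContinuousOn (fun p : ℝ × ℝ => L (u p.1, t) - L (v p.1, p.2)) (Icc 0 1 ×ˢ univ) :=
    hLu.sub hLv
  -- after `K` turns the second argument exceeds the first one
  obtain ⟨C, hC⟩ := (isCompact_Icc (a := (0 : ℝ)) (b := 1)).exists_bound_of_continuousOn
    (f := fun c => L (u c, t) - L (v c, s))
    (hDc.comp (f := fun c : ℝ => (c, s)) (by fun_prop) fun c hc => ⟨hc, mem_univ _⟩)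
  obtain ⟨K, hK⟩ := exists_nat_gt C
  have hpi := Real.pi_gt_three
  have hK0 : 0 ≤ (K : ℝ) := K.cast_nonneg
  obtain ⟨⟨c, τ⟩, ⟨hc, hτ⟩, hzero⟩ := exists_eq_zero_of_rectangle (a := 0) (b := 1) (c := s)
    (d := s + K * (2 * Real.pi)) (D := fun p => L (u p.1, t) - L (v p.1, p.2)) zero_le_one
    (by nlinarith) (hDc.mono (prod_mono_right (subset_univ _)))
    (fun τ _ => by simpa [u, v] using hcmp τ t)
    (fun τ _ => by simpa [u, v] using hcmp t τ)
    (fun c hc => by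
      have h1 := (hsepI _ (hu c hc)).1
      have h2 := (hsepI _ (hv c hc)).2
      simp only [sub_im]
      linarith)
    (fun c hc => by
      simp only
      rw [hpern K _ (hIoo _ (hv c hc))]
      have h1 := (abs_im_le_norm _).trans (hC c hc)
      have h2 := (le_abs_self _).trans h1
      simp only [sub_im] at h2
      simp
      nlinarith)
  simp only [sub_eq_zero] at hzero
  simp only at hc hτ
  have hfe : starPoint q (u c) t = starPoint q (v c) τ := by
    refine H.bijOn.injOn ?_ ?_ ?_
    · simpa using norm_starPoint_lt_one hq (hIoo _ (hu c hc)).1.le (hIoo _ (hu c hc)).2 t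
    · simpa using norm_starPoint_lt_one hq (hIoo _ (hv c hc)).1.le (hIoo _ (hv c hc)).2 τ
    · have := congrArg exp hzero
      rwa [hexp _ (hIoo _ (hu c hc)), hexp _ (hIoo _ (hv c hc))] at this
  obtain ⟨huv, hcirc⟩ := starPoint_inj hq (hIoo _ (hu c hc)).1 (hIoo _ (hv c hc)).1 hfe
  obtain ⟨n, hn⟩ : ∃ n : ℤ, τ = t + n * (2 * Real.pi) := by
    simp only [circleMap, ofReal_one, one_mul, zero_add] at hcirc
    obtain ⟨n, hn⟩ := Complex.exp_eq_exp_iff_exists_int.1 hcirc.symm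
    refine ⟨n, ?_⟩
    have := congrArg Complex.im hn
    simpa using this
  have hn0 : 0 < n := by
    have : (0 : ℝ) < n := by nlinarith [hτ.1]
    exact_mod_cast this
  lift n to ℕ using hn0.le
  have hcontra := hpern n _ (hIoo _ (hu c hc)) t
  rw [hn, ← huv] at hzero
  push_cast at hzero
  rw [← hzero] at hcontra
  have h3 : (n : ℂ) * (2 * Real.pi * I) = 0 := by linear_combination -hcontra
  rcases mul_eq_zero.1 h3 with h4 | h4
  · have : n = 0 := by exact_mod_cast h4
    omega
  · exact Complex.two_pi_I_ne_zero h4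

/-- If `φ` has a unimodular limit, then every continuous branch of `arg φ` converges to an argument
of the limit. -/
theorem exists_tendsto_im_log_lift {φ : ℝ → ℂ} {L : ℝ → ℂ} (hLc : ContinuousOn L (Ioo 0 1))
    (hexp : ∀ ρ ∈ Ioo (0 : ℝ) 1, exp (L ρ) = φ ρ) {F : ℂ} (hF : ‖F‖ = 1)
    (hφ : Tendsto φ (𝓝[<] 1) (𝓝 F)) :
    ∃ x : ℝ, Tendsto (fun ρ => (L ρ).im) (𝓝[<] 1) (𝓝 x) ∧ F = exp (x * I) := by
  have hF0 : F ≠ 0 := by rintro rfl; simp at hF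
  have hq : Tendsto (fun ρ => φ ρ / F) (𝓝[<] 1) (𝓝 1) := by
    simpa [hF0] using hφ.div_const F
  obtain ⟨ρ₁, hρ₁, hsub⟩ := (mem_nhdsLT_iff_exists_Ioo_subset).1
    (inter_mem (hq.eventually (isOpen_slitPlane.mem_nhds one_mem_slitPlane))
      (Ioo_mem_nhdsLT (zero_lt_one' ℝ)))
  have hexp' : ∀ ρ ∈ Ioo ρ₁ 1, exp (L ρ) = φ ρ := fun ρ hρ => hexp ρ (hsub hρ).2
  have hLc' : ContinuousOn L (Ioo ρ₁ 1) := hLc.mono fun ρ hρ => (hsub hρ).2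
  have hφc : ContinuousOn φ (Ioo ρ₁ 1) :=
    hLc'.cexp.congr fun ρ hρ => (hexp' ρ hρ).symm
  obtain ⟨n, hn⟩ := exists_int_eq_of_exp_eq_one (isPreconnected_Ioo (a := ρ₁) (b := 1))
    (φ := fun ρ => L ρ - log (φ ρ / F) - log F)
    ((hLc'.sub ((hφc.div_const F).clog fun ρ hρ => (hsub hρ).1)).sub continuousOn_const) (by
      intro ρ hρ
      have hne := slitPlane_ne_zero (hsub hρ).1
      rw [Complex.exp_sub, Complex.exp_sub, hexp' ρ hρ, exp_log hne, exp_log hF0,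
        div_div, div_mul_cancel₀ _ hF0, div_self]
      rintro h0
      simp [h0] at hne)
  refine ⟨F.arg + n * (2 * Real.pi), ?_, ?_⟩
  · have hlim : Tendsto (fun ρ => (log (φ ρ / F)).im + (F.arg + n * (2 * Real.pi))) (𝓝[<] 1)
        (𝓝 ((log 1).im + (F.arg + n * (2 * Real.pi)))) :=
      ((Complex.continuous_im.tendsto _).comp
        ((continuousAt_clog one_mem_slitPlane).tendsto.comp hq)).add_const _
    rw [Complex.log_one, zero_im, zero_add] at hlim
    refine hlim.congr' ?_
    filter_upwards [Ioo_mem_nhdsLT hρ₁] with ρ hρ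
    have := congrArg Complex.im (hn ρ hρ)
    simp only [sub_im, log_im F] at this
    simp at this
    linarith
  · have h1 : F = exp (F.arg * I) := by
      conv_lhs => rw [← norm_mul_exp_arg_mul_I F, hF]
      simp
    conv_lhs => rw [h1]
    rw [Complex.exp_eq_exp_iff_exists_int]
    refine ⟨-n, ?_⟩
    push_cast
    ring

/-- The boundary correspondence of a harmonic automorphism: almost everywhere on the circle `f` has
boundary values `e^{iξ}` with `ξ` increasing and `ξ(t + 2π) = ξ(t) + 2π`. -/
theorem exists_boundary_lift (H : IsHarmonicDiscAut h g) :
    ∃ (ξ : ℝ → ℝ) (S : Set ℝ), (∀ᵐ t, t ∈ S) ∧ MonotoneOn ξ S ∧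
      (∀ t, ξ (t + 2 * Real.pi) = ξ t + 2 * Real.pi) ∧
      ∀ t ∈ S, Tendsto (fun r => harmonicSum h g (circleMap 0 r t)) (𝓝[<] 1)
        (𝓝 (exp (ξ t * I))) := by
  classical
  obtain ⟨q, hq, h0⟩ := H.exists_zero
  obtain ⟨L, hLc, hexp, hper⟩ := H.exists_log_lift hq h0
  let S : Set ℝ := {t | ∃ F : ℂ, ∀ q : ℂ, ‖q‖ < 1 →
      Tendsto (fun ρ => harmonicSum h g (starPoint q ρ t)) (𝓝[<] 1) (𝓝 F)}
  have hSper : ∀ t, t + 2 * Real.pi ∈ S ↔ t ∈ S := fun t => by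
    simp only [S, mem_ofPred_eq, starPoint_add_two_pi]
  have hex : ∀ t ∈ S, ∃ x : ℝ, Tendsto (fun ρ => (L (ρ, t)).im) (𝓝[<] 1) (𝓝 x) ∧
      ∀ q : ℂ, ‖q‖ < 1 → Tendsto (fun ρ => harmonicSum h g (starPoint q ρ t)) (𝓝[<] 1)
        (𝓝 (exp (x * I))) := by
    rintro t ⟨F, hF⟩
    have hF1 : ‖F‖ = 1 := tendsto_nhds_unique (hF q hq).norm (H.tendsto_norm_starPoint hq t)
    obtain ⟨x, hx, rfl⟩ := exists_tendsto_im_log_lift (L := fun ρ => L (ρ, t))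
      (hLc.comp (f := fun ρ : ℝ => (ρ, t)) (by fun_prop) fun ρ hρ => ⟨hρ, mem_univ _⟩)
      (fun ρ hρ => hexp ρ hρ t) hF1 (hF q hq)
    exact ⟨x, hx, hF⟩
  choose! x hx hxF using hex
  -- off `S` any function with the same quasi-periodicity would do
  refine ⟨fun t => if t ∈ S then x t else t, S, H.ae_exists_tendsto_starPoint, ?_, ?_, ?_⟩
  · intro t ht s hs hts
    simp only [ht, hs, if_true]
    rcases hts.eq_or_lt with rfl | hlt
    · exact le_rfl
    · exact H.le_of_tendsto_im_log_lift hq hLc hexp hper hlt (hx t ht) (hx s hs)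
  · intro t
    by_cases ht : t ∈ S
    · simp only [ht, (hSper t).2 ht, if_true]
      refine tendsto_nhds_unique (hx _ ((hSper t).2 ht))
        (((hx t ht).add_const (2 * Real.pi)).congr' ?_)
      filter_upwards [Ioo_mem_nhdsLT (zero_lt_one' ℝ)] with ρ hρ
      rw [hper ρ hρ]
      simp
    · simp only [ht, mt (hSper t).1 ht, if_false]
  · intro t ht
    simp only [ht, if_true]
    simpa [starPoint, circleMap] using hxF t ht 0 (by simp)

end IsHarmonicDiscAut

/-! ### A sine inequality for increasing circle maps -/

theorem Real.sin_le_tangent {a u : ℝ} (ha : a ∈ Icc 0 Real.pi) (hu : u ∈ Ioo 0 Real.pi) :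
    Real.sin a ≤ Real.sin u + (a - u) * Real.cos u := by
  have hconc : ConcaveOn ℝ (Icc 0 Real.pi) Real.sin := strictConcaveOn_sin_Icc.concaveOn
  have hd := Real.hasDerivAt_sin u
  have humem : u ∈ Icc 0 Real.pi := ⟨hu.1.le, hu.2.le⟩
  rcases lt_trichotomy a u with h | h | h
  · have := hconc.le_slope_of_hasDerivAt ha humem h hd
    rw [slope_def_field, le_div_iff₀ (by linarith)] at this
    linarith
  · simp [h]
  · have := hconc.slope_le_of_hasDerivAt humem ha h hd
    rw [slope_def_field, div_le_iff₀ (by linarith)] at this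
    linarith

/-- Two consecutive arcs of total length at most `2π` satisfy a Jensen inequality for the sine,
although one of them may be longer than `π`, beyond the range of concavity. -/
theorem Real.sin_add_sin_le {x y u : ℝ} (hx : 0 ≤ x + y) (hy : x + y ≤ 2 * Real.pi)
    (hu : u ∈ Ioo 0 Real.pi) :
    Real.sin x + Real.sin y ≤ 2 * Real.sin u + (x + y - 2 * u) * Real.cos u := by
  have h1 : Real.sin x + Real.sin y =
      2 * Real.sin ((x + y) / 2) * Real.cos ((x - y) / 2) := by
    have hx' : x = (x + y) / 2 + (x - y) / 2 := by ring
    have hy' : y = (x + y) / 2 - (x - y) / 2 := by ring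
    conv_lhs => rw [hx', hy', Real.sin_add, Real.sin_sub]
    ring_nf
  have h2 : 0 ≤ Real.sin ((x + y) / 2) := Real.sin_nonneg_of_nonneg_of_le_pi (by linarith)
    (by linarith)
  have h3 := Real.sin_le_tangent (a := (x + y) / 2) ⟨by linarith, by linarith⟩ hu
  have h4 := Real.cos_le_one ((x - y) / 2)
  rw [h1]
  nlinarith

section MonotoneLift

variable {ξ : ℝ → ℝ} {S : Set ℝ}

theorem ae_add_mem (hS : ∀ᵐ t, t ∈ S) (u : ℝ) : ∀ᵐ t, t + u ∈ S :=
  (measurePreserving_add_right volume u).quasiMeasurePreserving.tendsto_ae.eventually hS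

theorem MonotoneOn.aemeasurable_of_ae_mem (hS : ∀ᵐ t, t ∈ S) (hmono : MonotoneOn ξ S) :
    AEMeasurable ξ volume := by
  set N := toMeasurable volume Sᶜ
  have hN : volume N = 0 := by rw [measure_toMeasurable]; exact hS
  have hNm : MeasurableSet N := measurableSet_toMeasurable _ _
  have hsub : Nᶜ ⊆ S := compl_subset_comm.1 (subset_toMeasurable _ _)
  have h1 := aemeasurable_restrict_of_monotoneOn (μ := volume) hNm.compl (hmono.mono hsub)
  have h2 : (volume : Measure ℝ).restrict Nᶜ = volume :=
    Measure.restrict_eq_self_of_ae_mem (by rw [ae_iff]; simpa using hN)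
  rwa [h2] at h1

theorem MonotoneOn.intervalIntegrable_of_ae_mem (hS : ∀ᵐ t, t ∈ S) (hmono : MonotoneOn ξ S)
    (a b : ℝ) : IntervalIntegrable ξ volume a b := by
  wlog hab : a ≤ b generalizing a b
  · exact (this b a (le_of_not_ge hab)).symm
  have hd : Dense S := Measure.dense_of_ae hS
  obtain ⟨s₀, hs₀, -, h0⟩ := hd.exists_between (sub_one_lt a)
  obtain ⟨s₁, hs₁, h1, -⟩ := hd.exists_between (lt_add_one b)
  rw [intervalIntegrable_iff]
  refine Measure.integrableOn_of_bounded (M := max |ξ s₀| |ξ s₁|) (by simp)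
    (MonotoneOn.aemeasurable_of_ae_mem hS hmono).aestronglyMeasurable ?_
  rw [uIoc_of_le hab]
  filter_upwards [ae_restrict_of_ae hS, ae_restrict_mem measurableSet_Ioc] with t ht htm
  exact abs_le_max_abs_abs (hmono hs₀ ht (by linarith [htm.1])) (hmono ht hs₁ (by linarith [htm.2]))

theorem integral_add_sub_of_quasiperiodic (hS : ∀ᵐ t, t ∈ S) (hmono : MonotoneOn ξ S)
    (hper : ∀ t, ξ (t + 2 * Real.pi) = ξ t + 2 * Real.pi) (v : ℝ) :
    ∫ t in (0 : ℝ)..2 * Real.pi, (ξ (t + v) - ξ t) = 2 * Real.pi * v := by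
  have hi := MonotoneOn.intervalIntegrable_of_ae_mem hS hmono
  let p : ℝ → ℝ := fun t => ξ t - t
  have hp : Function.Periodic p (2 * Real.pi) := fun t => by simp only [p, hper]; ring
  have hpi : ∀ a b, IntervalIntegrable p volume a b := fun a b =>
    (hi a b).sub (continuous_id.intervalIntegrable _ _)
  have hpi' : IntervalIntegrable (fun t => p (t + v)) volume 0 (2 * Real.pi) := by
    have := (hpi (0 + v) (2 * Real.pi + v)).comp_add_right v
    simpa using this
  have h1 : ∀ t, ξ (t + v) - ξ t = (p (t + v) - p t) + v := fun t => by simp only [p]; ring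
  simp_rw [h1]
  rw [intervalIntegral.integral_add (hpi'.sub (hpi _ _)) (by simp),
    intervalIntegral.integral_sub hpi' (hpi _ _), intervalIntegral.integral_comp_add_right,
    intervalIntegral.integral_const]
  have h2 := hp.intervalIntegral_add_eq (0 + v) 0
  rw [zero_add, zero_add, add_comm v] at h2
  rw [zero_add, h2]
  simp

/-- An increasing circle map of degree one does not increase the mean of the sine of the angle
between points at distance `u`. The arcs from `t` to `t + u` and from `t + u` to `t + 2 * u` have
the same mean, and together their images have length at most `2π` as `u < π`, so that
`Real.sin_add_sin_le` applies; the linear terms cancel in the mean. -/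
theorem integral_sin_sub_le (hS : ∀ᵐ t, t ∈ S) (hmono : MonotoneOn ξ S)
    (hper : ∀ t, ξ (t + 2 * Real.pi) = ξ t + 2 * Real.pi) {u : ℝ} (hu : u ∈ Ioo 0 Real.pi) :
    ∫ t in (0 : ℝ)..2 * Real.pi, Real.sin (ξ (t + u) - ξ t) ≤ 2 * Real.pi * Real.sin u := by
  have hi := MonotoneOn.intervalIntegrable_of_ae_mem hS hmono
  have hm := MonotoneOn.aemeasurable_of_ae_mem hS hmono
  have hi' : ∀ v a b, IntervalIntegrable (fun t => ξ (t + v)) volume a b := fun v a b => by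
    have := (hi (a + v) (b + v)).comp_add_right v
    simpa using this
  have hm' : ∀ v, AEMeasurable (fun t => ξ (t + v)) volume := fun v =>
    hm.comp_quasiMeasurePreserving (measurePreserving_add_right volume v).quasiMeasurePreserving
  let w : ℝ → ℝ := fun t => Real.sin (ξ (t + u) - ξ t)
  have hw : Function.Periodic w (2 * Real.pi) := fun t => by
    simp only [w]
    rw [add_right_comm, hper, hper, add_sub_add_right_eq_sub]
  have hwi : ∀ a b, IntervalIntegrable w volume a b := fun a b => by
    rw [intervalIntegrable_iff]
    exact Measure.integrableOn_of_bounded (M := 1) (by simp)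
      (Real.measurable_sin.comp_aemeasurable ((hm' u).sub hm)).aestronglyMeasurable
      (Eventually.of_forall fun t => Real.abs_sin_le_one _)
  have hwi' : IntervalIntegrable (fun t => w (t + u)) volume 0 (2 * Real.pi) := by
    have := (hwi (0 + u) (2 * Real.pi + u)).comp_add_right u
    simpa using this
  have hshift : ∫ t in (0 : ℝ)..2 * Real.pi, w (t + u) = ∫ t in (0 : ℝ)..2 * Real.pi, w t := by
    have h2 := hw.intervalIntegral_add_eq (0 + u) 0
    rw [zero_add, zero_add, add_comm u] at h2
    rw [intervalIntegral.integral_comp_add_right, zero_add, h2]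
  have hpi := Real.pi_pos
  have hle : ∫ t in (0 : ℝ)..2 * Real.pi, (w t + w (t + u)) ≤
      ∫ t in (0 : ℝ)..2 * Real.pi,
        (2 * Real.sin u + ((ξ (t + 2 * u) - ξ t) - 2 * u) * Real.cos u) := by
    refine intervalIntegral.integral_mono_ae (by linarith) ((hwi _ _).add hwi')
      ((by simp : IntervalIntegrable (fun _ => 2 * Real.sin u) volume 0 (2 * Real.pi)).add
        ((((hi' _ _ _).sub (hi _ _)).sub (by simp)).mul_const _)) ?_
    filter_upwards [hS, ae_add_mem hS (2 * u), ae_add_mem hS (2 * Real.pi)] with t h0 h2 h3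
    have e1 := hmono h0 h2 (by linarith [hu.1])
    have e2 := hmono h2 h3 (by linarith [hu.2])
    rw [hper] at e2
    have e3 := Real.sin_add_sin_le (x := ξ (t + u) - ξ t) (y := ξ (t + 2 * u) - ξ (t + u))
      (by linarith) (by linarith) hu
    have e4 : w (t + u) = Real.sin (ξ (t + 2 * u) - ξ (t + u)) := by
      simp only [w]; ring_nf
    simp only [e4]
    refine e3.trans (le_of_eq ?_)
    ring
  rw [intervalIntegral.integral_add (hwi _ _) hwi', hshift,
    intervalIntegral.integral_add (by simp)
      ((((hi' _ _ _).sub (hi _ _)).sub (by simp)).mul_const _),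
    intervalIntegral.integral_const, intervalIntegral.integral_mul_const,
    intervalIntegral.integral_sub ((hi' _ _ _).sub (hi _ _)) (by simp),
    integral_add_sub_of_quasiperiodic hS hmono hper] at hle
  simp at hle
  change ∫ t in (0 : ℝ)..2 * Real.pi, w t ≤ _
  nlinarith

end MonotoneLift

/-! ### Fourier expansions: correlations and areas -/

theorem integral_exp_int_mul_I (m : ℤ) :
    ∫ t in (0 : ℝ)..2 * Real.pi, exp (m * t * I) = if m = 0 then 2 * (Real.pi : ℂ) else 0 := by
  split_ifs with hm
  · simp [hm]
  · have hc : (m : ℂ) * I ≠ 0 := mul_ne_zero (by exact_mod_cast hm) I_ne_zero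
    have h1 : ∀ t : ℝ, exp (m * t * I) = exp (m * I * t) := fun t => by ring_nf
    simp_rw [h1]
    rw [integral_exp_mul_complex hc]
    have h2 : (m : ℂ) * I * ((2 * Real.pi : ℝ) : ℂ) = m * (2 * Real.pi * I) := by
      push_cast; ring
    rw [h2, Complex.exp_int_mul_two_pi_mul_I]
    simp

/-- Parseval's identity for absolutely convergent Fourier series with frequencies `k i`; a
frequency may occur twice if the corresponding products of coefficients vanish. -/
theorem hasSum_integral_conj_mul {ι : Type*} [Countable ι] {k : ι → ℤ} {A B : ι → ℂ}
    (hA : Summable fun i => ‖A i‖) (hB : Summable fun i => ‖B i‖)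
    (hk : ∀ i j, i ≠ j → k i = k j → starRingEnd ℂ (A i) * B j = 0) {φ ψ : ℝ → ℂ}
    (hφ : ∀ t : ℝ, HasSum (fun i => A i * exp (k i * t * I)) (φ t))
    (hψ : ∀ t : ℝ, HasSum (fun i => B i * exp (k i * t * I)) (ψ t)) :
    HasSum (fun i => 2 * Real.pi * (starRingEnd ℂ (A i) * B i))
      (∫ t in (0 : ℝ)..2 * Real.pi, starRingEnd ℂ (φ t) * ψ t) := by
  classical
  have hnorm : ∀ (m : ℤ) (t : ℝ), ‖exp (m * t * I)‖ = 1 := fun m t => by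
    have : (m : ℂ) * t * I = ((m * t : ℝ) : ℂ) * I := by push_cast; ring
    rw [this, norm_exp_ofReal_mul_I]
  have hterm : ∀ i, Continuous fun t : ℝ => A i * exp (k i * t * I) := fun i => by fun_prop
  have hφc : Continuous φ := by
    have : φ = fun t : ℝ => ∑' i, A i * exp (k i * t * I) := funext fun t => (hφ t).tsum_eq.symm
    rw [this]
    exact continuous_tsum hterm hA fun i t => by rw [norm_mul, hnorm, mul_one]
  have hφb : ∀ t, ‖φ t‖ ≤ ∑' i, ‖A i‖ := fun t => by
    rw [← (hφ t).tsum_eq]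
    refine tsum_of_norm_bounded hA.hasSum fun i => ?_
    rw [norm_mul, hnorm, mul_one]
  have step : ∀ j, ∫ t in (0 : ℝ)..2 * Real.pi, starRingEnd ℂ (φ t) * (B j * exp (k j * t * I)) =
      2 * Real.pi * (starRingEnd ℂ (A j) * B j) := by
    intro j
    have h1 : HasSum (fun i => ∫ t in (0 : ℝ)..2 * Real.pi,
        starRingEnd ℂ (A i * exp (k i * t * I)) * (B j * exp (k j * t * I)))
        (∫ t in (0 : ℝ)..2 * Real.pi, starRingEnd ℂ (φ t) * (B j * exp (k j * t * I))) := by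
      refine intervalIntegral.hasSum_integral_of_dominated_convergence
        (fun i _ => ‖A i‖ * ‖B j‖) (fun i => ?_) (fun i => ?_) ?_ ?_ ?_
      · exact Continuous.aestronglyMeasurable (by fun_prop)
      · refine Eventually.of_forall fun t _ => ?_
        rw [norm_mul, RCLike.norm_conj, norm_mul, norm_mul, hnorm, hnorm, mul_one, mul_one]
      · exact Eventually.of_forall fun t _ => hA.mul_right _
      · simp
      · refine Eventually.of_forall fun t _ => ?_
        exact (((hφ t).map (starRingEnd ℂ) Complex.continuous_conj).mul_right _)
    have h2 : ∀ i, ∫ t in (0 : ℝ)..2 * Real.pi,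
        starRingEnd ℂ (A i * exp (k i * t * I)) * (B j * exp (k j * t * I)) =
        if i = j then 2 * Real.pi * (starRingEnd ℂ (A j) * B j) else 0 := by
      intro i
      have h3 : ∀ t : ℝ, starRingEnd ℂ (A i * exp (k i * t * I)) * (B j * exp (k j * t * I)) =
          starRingEnd ℂ (A i) * B j * exp ((k j - k i : ℤ) * t * I) := by
        intro t
        have h4 : exp ((k j - k i : ℤ) * t * I) =
            exp (-(k i * t * I)) * exp (k j * t * I) := by
          rw [← Complex.exp_add]; push_cast; ring_nf
        rw [h4, map_mul, ← Complex.exp_conj]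
        simp only [map_mul, conj_I, conj_ofReal, map_intCast]
        ring_nf
      simp_rw [h3]
      rw [intervalIntegral.integral_const_mul, integral_exp_int_mul_I]
      by_cases hij : i = j
      · subst hij; simp; ring
      · rw [if_neg hij]
        by_cases hkk : k i = k j
        · rw [hk i j hij hkk, zero_mul]
        · rw [if_neg (by omega), mul_zero]
    simp_rw [h2] at h1
    exact h1.unique (hasSum_ite_eq j _)
  simp_rw [← step]
  refine intervalIntegral.hasSum_integral_of_dominated_convergence
    (fun j _ => (∑' i, ‖A i‖) * ‖B j‖) (fun j => ?_) (fun j => ?_) ?_ ?_ ?_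
  · exact Continuous.aestronglyMeasurable (by fun_prop)
  · refine Eventually.of_forall fun t _ => ?_
    rw [norm_mul, RCLike.norm_conj, norm_mul, hnorm, mul_one]
    exact mul_le_mul_of_nonneg_right (hφb t) (norm_nonneg _)
  · exact Eventually.of_forall fun t _ => hB.mul_left _
  · simp
  · exact Eventually.of_forall fun t _ => (hψ t).mul_left _

/-- The `n`-th Taylor coefficient at the origin. -/
noncomputable def taylorCoeff (F : ℂ → ℂ) (n : ℕ) : ℂ := (n.factorial : ℂ)⁻¹ * iteratedDeriv n F 0

theorem hasSum_taylorCoeff {F : ℂ → ℂ} (hF : DifferentiableOn ℂ F (ball 0 1)) {z : ℂ}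
    (hz : ‖z‖ < 1) : HasSum (fun n => taylorCoeff F n * z ^ n) (F z) := by
  have := Complex.hasSum_taylorSeries_on_ball hF (z := z) (by simpa using hz)
  refine this.congr_fun fun n => ?_
  simp only [taylorCoeff, sub_zero, smul_eq_mul]
  ring

theorem taylorCoeff_deriv (F : ℂ → ℂ) (n : ℕ) :
    taylorCoeff (deriv F) n = (n + 1) * taylorCoeff F (n + 1) := by
  have h1 : ((n.factorial : ℕ) : ℂ) ≠ 0 := by exact_mod_cast n.factorial_ne_zero
  have h2 : ((n : ℂ) + 1) ≠ 0 := by exact_mod_cast n.succ_ne_zero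
  simp only [taylorCoeff, iteratedDeriv_succ', Nat.factorial_succ]
  push_cast
  field_simp

theorem circleMap_zero_pow_eq (r t : ℝ) (n : ℕ) :
    circleMap 0 r t ^ n = (r ^ n : ℝ) * exp ((n : ℤ) * t * I) := by
  rw [circleMap, zero_add, mul_pow, ← Complex.exp_nat_mul]
  push_cast
  ring_nf

theorem summable_norm_taylorCoeff_mul_pow {F : ℂ → ℂ} (hF : DifferentiableOn ℂ F (ball 0 1)) {r : ℝ}
    (h0 : 0 ≤ r) (h1 : r < 1) : Summable fun n => ‖taylorCoeff F n * (r ^ n : ℝ)‖ := by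
  have := (hasSum_taylorCoeff hF (z := r) (by simpa [abs_of_nonneg h0] using h1)).summable.norm
  simpa using this

theorem hasSum_taylorCoeff_circleMap {F : ℂ → ℂ} (hF : DifferentiableOn ℂ F (ball 0 1)) {r : ℝ}
    (h0 : 0 ≤ r) (h1 : r < 1) (t : ℝ) :
    HasSum (fun n : ℕ => taylorCoeff F n * (r ^ n : ℝ) * exp ((n : ℤ) * t * I))
      (F (circleMap 0 r t)) := by
  have := hasSum_taylorCoeff hF (z := circleMap 0 r t) (by simpa [abs_of_nonneg h0] using h1)
  refine this.congr_fun fun n => ?_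
  rw [circleMap_zero_pow_eq]; ring

/-- The mean square of a holomorphic function on a circle. -/
theorem hasSum_integral_norm_sq {F : ℂ → ℂ} (hF : DifferentiableOn ℂ F (ball 0 1)) {r : ℝ}
    (h0 : 0 ≤ r) (h1 : r < 1) :
    HasSum (fun n : ℕ => 2 * Real.pi * (‖taylorCoeff F n‖ ^ 2 * r ^ (2 * n)))
      (∫ t in (0 : ℝ)..2 * Real.pi, ‖F (circleMap 0 r t)‖ ^ 2) := by
  have hs := summable_norm_taylorCoeff_mul_pow hF h0 h1
  have := hasSum_integral_conj_mul (k := fun n : ℕ => (n : ℤ)) hs hs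
    (fun i j hij h => absurd (by exact_mod_cast h) hij)
    (hasSum_taylorCoeff_circleMap hF h0 h1) (hasSum_taylorCoeff_circleMap hF h0 h1)
  rw [← Complex.hasSum_ofReal, ← intervalIntegral.integral_ofReal]
  convert this using 1
  · funext n
    rw [← Complex.normSq_eq_conj_mul_self, normSq_eq_norm_sq, norm_mul, norm_real,
      Real.norm_eq_abs, abs_of_nonneg (pow_nonneg h0 n)]
    push_cast
    ring
  · congr 1
    funext t
    rw [← Complex.normSq_eq_conj_mul_self, normSq_eq_norm_sq]

/-- The autocorrelation of a harmonic map on a circle. -/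
theorem hasSum_integral_conj_mul_harmonicSum {h g : ℂ → ℂ} (hh : DifferentiableOn ℂ h (ball 0 1))
    (hg : DifferentiableOn ℂ g (ball 0 1)) (hg0 : g 0 = 0) {r : ℝ} (h0 : 0 ≤ r) (h1 : r < 1)
    (u : ℝ) :
    HasSum (fun n : ℕ => 2 * Real.pi * (((‖taylorCoeff h n‖ ^ 2 * r ^ (2 * n) : ℝ) : ℂ) *
        exp ((n * u : ℝ) * I) + ((‖taylorCoeff g n‖ ^ 2 * r ^ (2 * n) : ℝ) : ℂ) *
        exp (-((n * u : ℝ) * I))))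
      (∫ t in (0 : ℝ)..2 * Real.pi, starRingEnd ℂ (harmonicSum h g (circleMap 0 r t)) *
        harmonicSum h g (circleMap 0 r (t + u))) := by
  let A : ℕ ⊕ ℕ → ℂ := Sum.elim (fun n => taylorCoeff h n * (r ^ n : ℝ))
    (fun n => starRingEnd ℂ (taylorCoeff g n * (r ^ n : ℝ)))
  let k : ℕ ⊕ ℕ → ℤ := Sum.elim (fun n => (n : ℤ)) (fun n => -(n : ℤ))
  have hb0 : taylorCoeff g 0 = 0 := by simp [taylorCoeff, hg0]
  have hA : Summable fun i => ‖A i‖ := by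
    refine (HasSum.sum (f := fun i => ‖A i‖)
      (summable_norm_taylorCoeff_mul_pow hh h0 h1).hasSum (b := ∑' n, ‖A (Sum.inr n)‖) ?_).summable
    refine Summable.hasSum (f := fun n => ‖A (Sum.inr n)‖) ?_
    simpa [A] using summable_norm_taylorCoeff_mul_pow hg h0 h1
  have hnorm : ∀ (m : ℤ) (t : ℝ), ‖exp (m * t * I)‖ = 1 := fun m t => by
    have : (m : ℂ) * t * I = ((m * t : ℝ) : ℂ) * I := by push_cast; ring
    rw [this, norm_exp_ofReal_mul_I]
  have hφ : ∀ t : ℝ, HasSum (fun i => A i * exp (k i * t * I))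
      (harmonicSum h g (circleMap 0 r t)) := by
    intro t
    refine HasSum.sum (f := fun i => A i * exp (k i * t * I))
      (by simpa [Function.comp_def, A, k] using hasSum_taylorCoeff_circleMap hh h0 h1 t) ?_
    have := (hasSum_taylorCoeff_circleMap hg h0 h1 t).map (starRingEnd ℂ) Complex.continuous_conj
    refine this.congr_fun fun n => ?_
    simp only [Function.comp_apply, A, k, Sum.elim_inr, map_mul, ← Complex.exp_conj, conj_ofReal,
      conj_I, map_intCast]
    push_cast
    ring_nf
  have hψ : ∀ t : ℝ, HasSum (fun i => (A i * exp (k i * u * I)) * exp (k i * t * I))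
      (harmonicSum h g (circleMap 0 r (t + u))) := by
    intro t
    refine (hφ (t + u)).congr_fun fun i => ?_
    rw [mul_assoc, ← Complex.exp_add]
    push_cast
    ring_nf
  have hB : Summable fun i => ‖A i * exp (k i * u * I)‖ := by
    simpa [norm_mul, hnorm] using hA
  have key := hasSum_integral_conj_mul (k := k) hA hB (by
    rintro (i | i) (j | j) hij hkk
    · exact absurd (by simpa [k] using hkk) (fun h : i = j => hij (by rw [h]))
    · have : j = 0 := by simp only [k, Sum.elim_inl, Sum.elim_inr] at hkk; omega
      subst this
      simp [A, hb0]
    · have : i = 0 := by simp only [k, Sum.elim_inl, Sum.elim_inr] at hkk; omega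
      subst this
      simp [A, hb0]
    · exact absurd (by simpa [k] using hkk) (fun h : i = j => hij (by rw [h]))) hφ hψ
  have s1 := (key.summable.comp_injective Sum.inl_injective).hasSum
  have s2 := (key.summable.comp_injective Sum.inr_injective).hasSum
  have htot := (HasSum.sum s1 s2).unique key
  rw [← htot]
  refine (s1.add s2).congr_fun fun n => ?_
  have e1 : ∀ w : ℂ, starRingEnd ℂ (w * (r ^ n : ℝ)) * (w * (r ^ n : ℝ)) =
      ((‖w‖ ^ 2 * r ^ (2 * n) : ℝ) : ℂ) := by
    intro w
    rw [← Complex.normSq_eq_conj_mul_self, normSq_eq_norm_sq, norm_mul, norm_real,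
      Real.norm_eq_abs, abs_of_nonneg (pow_nonneg h0 n)]
    push_cast
    ring
  have e2 := e1 (taylorCoeff h n)
  have e3 := e1 (taylorCoeff g n)
  simp only [Function.comp_apply, A, k, Sum.elim_inl, Sum.elim_inr, Complex.conj_conj]
  rw [← e2, ← e3]
  push_cast
  ring_nf

/-- Integration over a disc in polar coordinates. -/
theorem setIntegral_ball_eq_integral_circleMap {J : ℂ → ℝ} (hJ : ContinuousOn J (ball 0 1)) {r : ℝ}
    (h0 : 0 < r) (h1 : r < 1) :
    ∫ z in ball (0 : ℂ) r, J z =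
      ∫ ρ in (0 : ℝ)..r, ρ * ∫ t in (0 : ℝ)..2 * Real.pi, J (circleMap 0 ρ t) := by
  have hpi := Real.pi_pos
  let F : ℝ × ℝ → ℝ := fun p => p.1 * J (circleMap 0 p.1 p.2)
  have hcm : Continuous fun p : ℝ × ℝ => circleMap 0 p.1 p.2 := by unfold circleMap; fun_prop
  have hFc : ContinuousOn F (Icc 0 r ×ˢ Icc (-Real.pi) Real.pi) := by
    refine continuous_fst.continuousOn.mul (hJ.comp hcm.continuousOn fun p hp => ?_)
    simpa [abs_of_nonneg hp.1.1] using hp.1.2.trans_lt h1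
  have hFi : IntegrableOn F (Ioo 0 r ×ˢ Ioo (-Real.pi) Real.pi) (volume.prod volume) :=
    (hFc.integrableOn_compact (isCompact_Icc.prod isCompact_Icc)).mono_set
      (prod_mono Ioo_subset_Icc_self Ioo_subset_Icc_self)
  rw [← integral_indicator measurableSet_ball, ← Complex.integral_comp_polarCoord_symm]
  have e1 : ∀ p ∈ polarCoord.target,
      p.1 • (ball (0 : ℂ) r).indicator J (Complex.polarCoord.symm p) =
        (Iio r ×ˢ univ).indicator F p := by
    intro p hp
    have hp1 : 0 < p.1 := hp.1
    have e2 : Complex.polarCoord.symm p = circleMap 0 p.1 p.2 := by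
      rw [Complex.polarCoord_symm_apply, circleMap, zero_add, Complex.exp_mul_I]
      push_cast
      ring
    rw [e2]
    by_cases hr : p.1 < r
    · rw [indicator_of_mem (by simpa [abs_of_pos hp1] using hr),
        indicator_of_mem (by exact ⟨hr, mem_univ _⟩), smul_eq_mul]
    · rw [indicator_of_notMem (by simpa [abs_of_pos hp1] using hr),
        indicator_of_notMem (fun h => hr h.1), smul_zero]
  have htm : MeasurableSet polarCoord.target := polarCoord.open_target.measurableSet
  rw [setIntegral_congr_fun htm e1, setIntegral_indicator (measurableSet_Iio.prod .univ)]
  have e3 : polarCoord.target ∩ (Iio r ×ˢ univ) = Ioo 0 r ×ˢ Ioo (-Real.pi) Real.pi := by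
    ext p
    simp only [polarCoord_target, mem_inter_iff, mem_prod, mem_Ioi, mem_Iio, mem_univ, mem_Ioo]
    tauto
  rw [e3, Measure.volume_eq_prod, setIntegral_prod _ hFi, ← integral_Ioc_eq_integral_Ioo,
    ← intervalIntegral.integral_of_le h0.le]
  congr 1
  funext ρ
  rw [← integral_Ioc_eq_integral_Ioo, ← intervalIntegral.integral_of_le (by linarith)]
  simp only [F]
  rw [intervalIntegral.integral_const_mul]
  congr 1
  have hper : Function.Periodic (fun t => J (circleMap 0 ρ t)) (2 * Real.pi) := fun t => by
    simp only [periodic_circleMap 0 ρ t]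
  have := hper.intervalIntegral_add_eq (-Real.pi) 0
  rw [zero_add] at this
  rw [← this]
  congr 1
  ring

namespace IsHarmonicDiscAut

variable {h g : ℂ → ℂ}

theorem continuousOn_jacobian (H : IsHarmonicDiscAut h g) :
    ContinuousOn (fun z => ‖deriv h z‖ ^ 2 - ‖deriv g z‖ ^ 2) (ball 0 1) :=
  ((H.diff_left.deriv isOpen_ball).continuousOn.norm.pow 2).sub
    ((H.diff_right.deriv isOpen_ball).continuousOn.norm.pow 2)

theorem hasSum_integral_jacobian (H : IsHarmonicDiscAut h g) {ρ : ℝ} (h0 : 0 ≤ ρ) (h1 : ρ < 1) :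
    HasSum (fun n : ℕ => 2 * Real.pi * (((n : ℝ) + 1) ^ 2 *
        (‖taylorCoeff h (n + 1)‖ ^ 2 - ‖taylorCoeff g (n + 1)‖ ^ 2) * ρ ^ (2 * n)))
      (∫ t in (0 : ℝ)..2 * Real.pi,
        (‖deriv h (circleMap 0 ρ t)‖ ^ 2 - ‖deriv g (circleMap 0 ρ t)‖ ^ 2)) := by
  have hh := H.diff_left.deriv isOpen_ball
  have hg := H.diff_right.deriv isOpen_ball
  have s1 := hasSum_integral_norm_sq hh h0 h1
  have s2 := hasSum_integral_norm_sq hg h0 h1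
  have c1 : Continuous fun t : ℝ => ‖deriv h (circleMap 0 ρ t)‖ ^ 2 :=
    (continuous_circleMap_comp hh.continuousOn h0 h1).norm.pow 2
  have c2 : Continuous fun t : ℝ => ‖deriv g (circleMap 0 ρ t)‖ ^ 2 :=
    (continuous_circleMap_comp hg.continuousOn h0 h1).norm.pow 2
  rw [intervalIntegral.integral_sub (c1.intervalIntegrable _ _) (c2.intervalIntegrable _ _)]
  refine (s1.sub s2).congr_fun fun n => ?_
  have hn : ‖(n : ℂ) + 1‖ = n + 1 := by
    rw [← Nat.cast_succ, Complex.norm_natCast]; push_cast; ring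
  rw [taylorCoeff_deriv, taylorCoeff_deriv, norm_mul, norm_mul, hn]
  ring

/-- The area formula `|f(𝔻_r)| = π ∑ n (|aₙ|² - |bₙ|²) r^{2n}` for
`f = ∑ aₙ zⁿ + conj ∑ bₙ zⁿ`. -/
theorem exists_hasSum_volume_image (H : IsHarmonicDiscAut h g) {r : ℝ} (h0 : 0 < r) (h1 : r < 1) :
    ∃ A : ℝ, HasSum (fun n : ℕ => (n : ℝ) * (‖taylorCoeff h n‖ ^ 2 - ‖taylorCoeff g n‖ ^ 2) *
        (r ^ 2) ^ n) A ∧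
      volume (harmonicSum h g '' ball 0 r) = ENNReal.ofReal (Real.pi * A) := by
  set J : ℂ → ℝ := fun z => ‖deriv h z‖ ^ 2 - ‖deriv g z‖ ^ 2
  have hJc : ContinuousOn J (ball 0 1) := H.continuousOn_jacobian
  have hsub : ball (0 : ℂ) r ⊆ ball 0 1 := ball_subset_ball h1.le
  have hvol : volume (harmonicSum h g '' ball 0 r) =
      ENNReal.ofReal (∫ z in ball (0 : ℂ) r, J z) := by
    rw [← lintegral_abs_det_fderiv_eq_addHaar_image volume measurableSet_ball
      (fun z hz => (H.hasStrictFDerivAt (hsub hz)).hasFDerivAt.hasFDerivWithinAt)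
      (H.bijOn.injOn.mono hsub), ofReal_integral_eq_lintegral_ofReal]
    · refine setLIntegral_congr_fun measurableSet_ball fun z hz => ?_
      simp only [det_wirtingerCLM]
      rw [abs_of_pos (H.jacobian_pos (hsub hz))]
    · exact ((hJc.mono (closedBall_subset_ball h1)).integrableOn_compact
        (isCompact_closedBall 0 r)).mono_set ball_subset_closedBall
    · filter_upwards [ae_restrict_mem measurableSet_ball] with z hz
      exact (H.jacobian_pos (hsub hz)).le
  let c : ℕ → ℝ := fun n => ((n : ℝ) + 1) ^ 2 *
    (‖taylorCoeff h (n + 1)‖ ^ 2 - ‖taylorCoeff g (n + 1)‖ ^ 2)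
  have hs := H.hasSum_integral_jacobian h0.le h1
  have hsum : HasSum (fun n : ℕ => ∫ ρ in (0 : ℝ)..r, ρ * (2 * Real.pi * (c n * ρ ^ (2 * n))))
      (∫ ρ in (0 : ℝ)..r, ρ * ∫ t in (0 : ℝ)..2 * Real.pi, J (circleMap 0 ρ t)) := by
    refine intervalIntegral.hasSum_integral_of_dominated_convergence
      (fun n _ => r * |2 * Real.pi * (c n * r ^ (2 * n))|) (fun n => ?_) (fun n => ?_) ?_ ?_ ?_
    · exact Continuous.aestronglyMeasurable (by fun_prop)
    · refine Eventually.of_forall fun ρ hρ => ?_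
      rw [uIoc_of_le h0.le] at hρ
      rw [Real.norm_eq_abs, abs_mul, abs_of_pos hρ.1, abs_mul (2 * Real.pi), abs_mul (2 * Real.pi),
        abs_mul (c n), abs_mul (c n), abs_of_nonneg (pow_nonneg hρ.1.le _),
        abs_of_nonneg (pow_nonneg h0.le _)]
      have := hρ.1
      have := hρ.2
      gcongr
    · exact Eventually.of_forall fun ρ _ => (hs.summable.abs).mul_left r
    · simp
    · refine Eventually.of_forall fun ρ hρ => ?_
      rw [uIoc_of_le h0.le] at hρ
      exact (H.hasSum_integral_jacobian hρ.1.le (hρ.2.trans_lt h1)).mul_left ρ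
  rw [← setIntegral_ball_eq_integral_circleMap hJc h0 h1] at hsum
  refine ⟨(∫ z in ball (0 : ℂ) r, J z) / Real.pi, ?_, ?_⟩
  · rw [← hasSum_nat_add_iff' 1]
    simp only [Finset.range_one, Finset.sum_singleton, Nat.cast_zero, zero_mul, sub_zero]
    refine (hsum.div_const Real.pi).congr_fun fun n => ?_
    have e1 : ∀ ρ : ℝ, ρ * (2 * Real.pi * (c n * ρ ^ (2 * n))) =
        2 * Real.pi * c n * ρ ^ (2 * n + 1) := fun ρ => by ring
    simp_rw [e1]
    rw [intervalIntegral.integral_const_mul, integral_pow]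
    have hpi := Real.pi_pos.ne'
    have hn : (n : ℝ) + 1 ≠ 0 := by positivity
    have hn2 : (2 * (n : ℝ) + 1 + 1) ≠ 0 := by positivity
    simp only [c]
    push_cast
    field_simp
    ring
  · rw [hvol, mul_div_cancel₀ _ Real.pi_pos.ne']

end IsHarmonicDiscAut

/-! ### A positive kernel with sine coefficients `n qⁿ` -/

theorem integral_sin_nat_mul_sin_nat (m n : ℕ) :
    ∫ u in (0 : ℝ)..Real.pi, Real.sin (m * u) * Real.sin (n * u) =
      if m = n ∧ n ≠ 0 then Real.pi / 2 else 0 := by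
  have hcos : ∀ k : ℤ, ∫ u in (0 : ℝ)..Real.pi, Real.cos (k * u) =
      if k = 0 then Real.pi else 0 := by
    intro k
    split_ifs with hk
    · simp [hk]
    · have hk' : (k : ℝ) ≠ 0 := by exact_mod_cast hk
      rw [intervalIntegral.integral_comp_mul_left (fun x => Real.cos x) hk', integral_cos]
      simp
  have h1 : ∀ u : ℝ, Real.sin (m * u) * Real.sin (n * u) =
      (Real.cos (((m - n : ℤ) : ℝ) * u) - Real.cos (((m + n : ℤ) : ℝ) * u)) / 2 := by
    intro u
    push_cast
    rw [sub_mul, add_mul, Real.cos_sub, Real.cos_add]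
    ring
  simp_rw [h1]
  rw [intervalIntegral.integral_div, intervalIntegral.integral_sub
    (Continuous.intervalIntegrable (by fun_prop) _ _)
    (Continuous.intervalIntegrable (by fun_prop) _ _), hcos, hcos]
  by_cases hmn : m = n
  · subst hmn
    by_cases hm : m = 0
    · simp [hm]
    · have : ¬ ((m : ℤ) + m = 0) := by omega
      simp [this, hm]
  · have h2 : ¬ ((m : ℤ) - n = 0) := by omega
    have h3 : ¬ ((m : ℤ) + n = 0) := by omega
    simp [h2, h3, hmn]

theorem integral_tsum_sin_mul_sin {c : ℕ → ℝ} (hc : Summable fun n => |c n|) {φ : ℝ → ℝ}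
    (hφ : ∀ u, HasSum (fun n : ℕ => c n * Real.sin (n * u)) (φ u)) {m : ℕ} (hm : m ≠ 0) :
    ∫ u in (0 : ℝ)..Real.pi, φ u * Real.sin (m * u) = Real.pi / 2 * c m := by
  have h1 : HasSum (fun n : ℕ => ∫ u in (0 : ℝ)..Real.pi,
      c n * Real.sin (n * u) * Real.sin (m * u))
      (∫ u in (0 : ℝ)..Real.pi, φ u * Real.sin (m * u)) := by
    refine intervalIntegral.hasSum_integral_of_dominated_convergence (fun n _ => |c n|)
      (fun n => Continuous.aestronglyMeasurable (by fun_prop))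
      (fun n => Eventually.of_forall fun u _ => ?_) (Eventually.of_forall fun _ _ => hc) (by simp)
      (Eventually.of_forall fun u _ => (hφ u).mul_right _)
    rw [Real.norm_eq_abs, abs_mul, abs_mul, mul_assoc]
    exact mul_le_of_le_one_right (abs_nonneg _)
      (mul_le_one₀ (Real.abs_sin_le_one _) (abs_nonneg _) (Real.abs_sin_le_one _))
  refine h1.unique ?_
  have h2 : ∀ n : ℕ, ∫ u in (0 : ℝ)..Real.pi, c n * Real.sin (n * u) * Real.sin (m * u) =
      if n = m then Real.pi / 2 * c m else 0 := by
    intro n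
    simp_rw [mul_assoc]
    rw [intervalIntegral.integral_const_mul, integral_sin_nat_mul_sin_nat]
    by_cases hnm : n = m
    · subst hnm; simp [hm]; ring
    · simp [hnm]
  simp_rw [h2]
  exact hasSum_ite_eq m _

theorem continuous_of_hasSum_sin {c : ℕ → ℝ} (hc : Summable fun n => |c n|) {φ : ℝ → ℝ}
    (hφ : ∀ u, HasSum (fun n : ℕ => c n * Real.sin (n * u)) (φ u)) : Continuous φ := by
  have : φ = fun u : ℝ => ∑' n : ℕ, c n * Real.sin (n * u) := funext fun u => (hφ u).tsum_eq.symm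
  rw [this]
  refine continuous_tsum (fun n => by fun_prop) hc fun n u => ?_
  rw [Real.norm_eq_abs, abs_mul]
  exact mul_le_of_le_one_right (abs_nonneg _) (Real.abs_sin_le_one _)

/-- The sine series with coefficients `n qⁿ` is the imaginary part of the Koebe function
`w / (1 - w)²` at `w = q e^{iu}`, hence positive on `(0, π)`. -/
theorem exists_hasSum_koebe_sin {q : ℝ} (hq0 : 0 < q) (hq1 : q < 1) :
    ∃ k : ℝ → ℝ, (∀ u, HasSum (fun n : ℕ => (n * q ^ n) * Real.sin (n * u)) (k u)) ∧
      ∀ u ∈ Ioo 0 Real.pi, 0 < k u := by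
  let w : ℝ → ℂ := fun u => q * exp (u * I)
  have hw : ∀ u, ‖w u‖ < 1 := fun u => by
    simp only [w, norm_mul, norm_exp_ofReal_mul_I, mul_one, norm_real, Real.norm_eq_abs,
      abs_of_pos hq0, hq1]
  refine ⟨fun u => (w u / (1 - w u) ^ 2).im, fun u => ?_, fun u hu => ?_⟩
  · have := Complex.hasSum_im (hasSum_coe_mul_geometric_of_norm_lt_one (hw u))
    refine this.congr_fun fun n => ?_
    have e1 : (n : ℂ) * w u ^ n = ((n * q ^ n : ℝ) : ℂ) * exp ((n * u : ℝ) * I) := by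
      simp only [w, mul_pow, ← Complex.exp_nat_mul]
      push_cast
      ring_nf
    rw [e1, im_ofReal_mul, exp_ofReal_mul_I_im]
  · have hne : 1 - w u ≠ 0 := fun h => by
      have h2 := hw u
      rw [← sub_eq_zero.1 h, norm_one] at h2
      exact lt_irrefl _ h2
    have hre : (w u).re = q * Real.cos u := by
      simp [w, exp_ofReal_mul_I_re]
    have him : (w u).im = q * Real.sin u := by
      simp [w, exp_ofReal_mul_I_im]
    have hnum : w u / (1 - w u) ^ 2 =
        (((normSq (1 - w u) ^ 2)⁻¹ : ℝ) : ℂ) * (w u * starRingEnd ℂ (1 - w u) ^ 2) := by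
      have h3 : ((normSq (1 - w u) : ℝ) : ℂ) = (1 - w u) * starRingEnd ℂ (1 - w u) :=
        (mul_conj _).symm
      have h4 : starRingEnd ℂ (1 - w u) ≠ 0 := (map_ne_zero _).2 hne
      push_cast
      rw [h3]
      field_simp
    have hsin := Real.sin_pos_of_pos_of_lt_pi hu.1 hu.2
    have hval : (w u * starRingEnd ℂ (1 - w u) ^ 2).im = q * Real.sin u * (1 - q ^ 2) := by
      simp only [pow_two, mul_im, mul_re, conj_re, conj_im, sub_re, sub_im, one_re, one_im, hre,
        him]
      linear_combination (q ^ 3 * Real.sin u) * (- Real.sin_sq_add_cos_sq u)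
    change 0 < (w u / (1 - w u) ^ 2).im
    rw [hnum, im_ofReal_mul, hval]
    have := normSq_pos.2 hne
    have : 0 < 1 - q ^ 2 := by nlinarith
    positivity

/-- If a sine series is bounded by `sin u` on `(0, π)`, integration against the positive kernel
with coefficients `n qⁿ` compares the sums `∑ n d_n qⁿ`. -/
theorem tsum_le_of_sin_series_le {d : ℕ → ℝ} (hd : Summable fun n => |d n|) {φ : ℝ → ℝ}
    (hφ : ∀ u, HasSum (fun n : ℕ => d n * Real.sin (n * u)) (φ u))
    (hle : ∀ u ∈ Ioo 0 Real.pi, φ u ≤ Real.sin u) {q : ℝ} (hq0 : 0 < q) (hq1 : q < 1) {A : ℝ}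
    (hA : HasSum (fun n : ℕ => n * d n * q ^ n) A) : A ≤ q ∧ (A = q → d 1 = 1) := by
  obtain ⟨k, hk, hkpos⟩ := exists_hasSum_koebe_sin hq0 hq1
  have hks : Summable fun n : ℕ => |(n * q ^ n : ℝ)| := by
    have := (hasSum_coe_mul_geometric_of_norm_lt_one (𝕜 := ℝ) (r := q)
      (by rwa [Real.norm_eq_abs, abs_of_pos hq0])).summable
    exact this.abs
  have hφc := continuous_of_hasSum_sin hd hφ
  have hkc := continuous_of_hasSum_sin hks hk
  have hpi := Real.pi_pos
  have e1 : ∫ u in (0 : ℝ)..Real.pi, Real.sin u * k u = Real.pi / 2 * q := by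
    have := integral_tsum_sin_mul_sin hks hk one_ne_zero
    simp only [Nat.cast_one, one_mul, pow_one] at this
    rw [← this]
    congr 1
    funext u
    ring
  have e2 : ∫ u in (0 : ℝ)..Real.pi, φ u * k u = Real.pi / 2 * A := by
    have h1 : HasSum (fun n : ℕ => ∫ u in (0 : ℝ)..Real.pi, d n * Real.sin (n * u) * k u)
        (∫ u in (0 : ℝ)..Real.pi, φ u * k u) := by
      refine intervalIntegral.hasSum_integral_of_dominated_convergence (fun n u => |d n| * |k u|)
        (fun n => Continuous.aestronglyMeasurable (by fun_prop))
        (fun n => Eventually.of_forall fun u _ => ?_)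
        (Eventually.of_forall fun u _ => hd.mul_right _) ?_
        (Eventually.of_forall fun u _ => (hφ u).mul_right _)
      · rw [Real.norm_eq_abs, abs_mul, abs_mul]
        exact mul_le_mul_of_nonneg_right
          (mul_le_of_le_one_right (abs_nonneg _) (Real.abs_sin_le_one _)) (abs_nonneg _)
      · simp_rw [tsum_mul_right]
        exact (continuous_const.mul hkc.abs).intervalIntegrable _ _
    refine h1.unique ((hA.mul_left (Real.pi / 2)).congr_fun fun n => ?_)
    have h2 : ∀ u : ℝ, d n * Real.sin (n * u) * k u = d n * (k u * Real.sin (n * u)) :=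
      fun u => by ring
    simp_rw [h2]
    rw [intervalIntegral.integral_const_mul]
    by_cases hn : n = 0
    · simp [hn]
    · rw [integral_tsum_sin_mul_sin hks hk hn]; ring
  have e3 : ∫ u in (0 : ℝ)..Real.pi, (Real.sin u - φ u) * k u = Real.pi / 2 * (q - A) := by
    have c1 : Continuous fun u => Real.sin u * k u := Real.continuous_sin.mul hkc
    have c2 : Continuous fun u => φ u * k u := hφc.mul hkc
    simp_rw [sub_mul]
    rw [intervalIntegral.integral_sub (c1.intervalIntegrable _ _) (c2.intervalIntegrable _ _),
      e1, e2]
    ring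
  have hφpi : φ Real.pi = 0 :=
    (hφ Real.pi).unique (by simp [Real.sin_nat_mul_pi])
  have hφ0 : φ 0 = 0 := (hφ 0).unique (by simp)
  have hnn : ∀ u ∈ Icc 0 Real.pi, 0 ≤ (Real.sin u - φ u) * k u := by
    intro u hu
    rcases hu.1.eq_or_lt with h | h
    · simp [← h, hφ0]
    rcases hu.2.eq_or_lt with h' | h'
    · simp [h', hφpi]
    · exact mul_nonneg (sub_nonneg.2 (hle u ⟨h, h'⟩)) (hkpos u ⟨h, h'⟩).le
  have hge := intervalIntegral.integral_nonneg (μ := volume) hpi.le hnn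
  rw [e3] at hge
  refine ⟨by nlinarith, fun hAq => ?_⟩
  -- equality of the integrals forces `φ = sin`, hence equality of the first coefficients
  have heq : ∀ u ∈ Icc 0 Real.pi, φ u = Real.sin u := by
    intro u hu
    rcases hu.1.eq_or_lt with h | h
    · simp [← h, hφ0]
    rcases hu.2.eq_or_lt with h' | h'
    · simp [h', hφpi]
    by_contra hne
    have hlt : φ u < Real.sin u := lt_of_le_of_ne (hle u ⟨h, h'⟩) hne
    have hpos := intervalIntegral.integral_pos (f := fun u => (Real.sin u - φ u) * k u) hpi
      ((Real.continuous_sin.sub hφc).mul hkc).continuousOn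
      (fun x hx => hnn x ⟨hx.1.le, hx.2⟩)
      ⟨u, hu, mul_pos (sub_pos.2 hlt) (hkpos u ⟨h, h'⟩)⟩
    rw [e3, hAq] at hpos
    simp at hpos
  have e4 := integral_tsum_sin_mul_sin hd hφ one_ne_zero
  have e5 := integral_sin_nat_mul_sin_nat 1 1
  have e6 : ∫ u in (0 : ℝ)..Real.pi, φ u * Real.sin ((1 : ℕ) * u) =
      ∫ u in (0 : ℝ)..Real.pi, Real.sin ((1 : ℕ) * u) * Real.sin ((1 : ℕ) * u) := by
    refine intervalIntegral.integral_congr fun u hu => ?_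
    rw [uIcc_of_le hpi.le] at hu
    simp [heq u hu]
  rw [e6, e5] at e4
  simp at e4
  exact e4

/-! ### The area inequality and its equality case -/

namespace IsHarmonicDiscAut

variable {h g : ℂ → ℂ}

theorem sum_norm_taylorCoeff_sq_le_one (H : IsHarmonicDiscAut h g) (s : Finset ℕ) :
    ∑ n ∈ s, (‖taylorCoeff h n‖ ^ 2 + ‖taylorCoeff g n‖ ^ 2) ≤ 1 := by
  have hpi := Real.pi_pos
  have key : ∀ r ∈ Ioo (0 : ℝ) 1,
      ∑ n ∈ s, (‖taylorCoeff h n‖ ^ 2 + ‖taylorCoeff g n‖ ^ 2) * r ^ (2 * n) ≤ 1 := by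
    intro r hr
    have hsum := Complex.hasSum_re (hasSum_integral_conj_mul_harmonicSum H.diff_left H.diff_right
      H.right_zero hr.1.le hr.2 0)
    have hle := intervalIntegral.norm_integral_le_of_norm_le_const (a := 0) (b := 2 * Real.pi)
      (C := 1) (f := fun t => starRingEnd ℂ (harmonicSum h g (circleMap 0 r t)) *
        harmonicSum h g (circleMap 0 r (t + 0))) fun t _ => by
      have hb : ∀ t, ‖harmonicSum h g (circleMap 0 r t)‖ ≤ 1 := fun t =>
        (H.norm_lt_one (by simpa [abs_of_pos hr.1] using hr.2)).le
      rw [norm_mul, RCLike.norm_conj]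
      exact mul_le_one₀ (hb _) (norm_nonneg _) (hb _)
    rw [sub_zero, abs_of_pos (by positivity), one_mul] at hle
    have hterm : ∀ n : ℕ, (2 * Real.pi * (((‖taylorCoeff h n‖ ^ 2 * r ^ (2 * n) : ℝ) : ℂ) *
        exp ((n * 0 : ℝ) * I) + ((‖taylorCoeff g n‖ ^ 2 * r ^ (2 * n) : ℝ) : ℂ) *
        exp (-((n * 0 : ℝ) * I)))).re =
        2 * Real.pi * ((‖taylorCoeff h n‖ ^ 2 + ‖taylorCoeff g n‖ ^ 2) * r ^ (2 * n)) := by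
      intro n
      rw [mul_zero, ofReal_zero, zero_mul, neg_zero, exp_zero, mul_one, mul_one, ← ofReal_add,
        ← ofReal_ofNat, ← ofReal_mul, ← ofReal_mul, ofReal_re]
      ring
    simp_rw [hterm] at hsum
    have hr0 := hr.1
    have h2 := (sum_le_hasSum s (fun n _ => by positivity) hsum).trans
      ((Complex.re_le_norm _).trans hle)
    rw [← Finset.mul_sum] at h2
    exact le_of_mul_le_mul_left (by linarith) (by positivity : 0 < 2 * Real.pi)
  have hlim : Tendsto (fun r : ℝ =>
      ∑ n ∈ s, (‖taylorCoeff h n‖ ^ 2 + ‖taylorCoeff g n‖ ^ 2) * r ^ (2 * n)) (𝓝[<] 1)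
      (𝓝 (∑ n ∈ s, (‖taylorCoeff h n‖ ^ 2 + ‖taylorCoeff g n‖ ^ 2) * 1 ^ (2 * n))) :=
    tendsto_nhdsWithin_of_tendsto_nhds (Continuous.tendsto (by fun_prop) 1)
  simp only [one_pow, mul_one] at hlim
  exact le_of_tendsto hlim (by
    filter_upwards [Ioo_mem_nhdsLT (zero_lt_one' ℝ)] with r hr using key r hr)

theorem summable_norm_taylorCoeff_sq (H : IsHarmonicDiscAut h g) :
    Summable fun n => ‖taylorCoeff h n‖ ^ 2 + ‖taylorCoeff g n‖ ^ 2 :=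
  summable_of_sum_le (fun _ => by positivity) H.sum_norm_taylorCoeff_sq_le_one

theorem summable_abs_sub_norm_taylorCoeff_sq (H : IsHarmonicDiscAut h g) :
    Summable fun n => |‖taylorCoeff h n‖ ^ 2 - ‖taylorCoeff g n‖ ^ 2| :=
  H.summable_norm_taylorCoeff_sq.of_nonneg_of_le (fun _ => abs_nonneg _) fun n => by
    rw [abs_le]
    constructor <;> nlinarith [sq_nonneg ‖taylorCoeff h n‖, sq_nonneg ‖taylorCoeff g n‖]

/-- The imaginary part of the correlation of the boundary values at lag `u`, expanded in a sine
series, is at most `sin u`: as `r → 1`, the correlation on the circle of radius `r` tends to the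
mean of `e^{i(ξ(t + u) - ξ(t))}`, where `e^{iξ}` are the boundary values of `f`. -/
theorem tsum_sin_le_sin (H : IsHarmonicDiscAut h g) {u : ℝ} (hu : u ∈ Ioo 0 Real.pi) :
    ∑' n : ℕ, (‖taylorCoeff h n‖ ^ 2 - ‖taylorCoeff g n‖ ^ 2) * Real.sin (n * u) ≤ Real.sin u := by
  obtain ⟨ξ, S, hS, hmono, hper, hlim⟩ := H.exists_boundary_lift
  have hpi := Real.pi_pos
  set d : ℕ → ℝ := fun n => ‖taylorCoeff h n‖ ^ 2 - ‖taylorCoeff g n‖ ^ 2 with hd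
  let G : ℝ → ℝ → ℂ := fun r t => starRingEnd ℂ (harmonicSum h g (circleMap 0 r t)) *
    harmonicSum h g (circleMap 0 r (t + u))
  have hIoo := Ioo_mem_nhdsLT (zero_lt_one' ℝ)
  have hGc : ∀ r ∈ Ioo (0 : ℝ) 1, Continuous (G r) := fun r hr => by
    have := continuous_circleMap_comp H.continuousOn hr.1.le hr.2
    exact (Complex.continuous_conj.comp this).mul (this.comp (continuous_add_const u))
  have hseries : ∀ r ∈ Ioo (0 : ℝ) 1, ∑' n : ℕ, d n * r ^ (2 * n) * Real.sin (n * u) =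
      (2 * Real.pi)⁻¹ * ∫ t in (0 : ℝ)..2 * Real.pi, (G r t).im := by
    intro r hr
    have hsum := Complex.hasSum_im (hasSum_integral_conj_mul_harmonicSum H.diff_left H.diff_right
      H.right_zero hr.1.le hr.2 u)
    have hcomm := Complex.imCLM.intervalIntegral_comp_comm
      ((hGc r hr).intervalIntegrable (μ := volume) 0 (2 * Real.pi))
    simp only [imCLM_apply] at hcomm
    rw [hcomm, ← (hsum.mul_left (2 * Real.pi)⁻¹).tsum_eq]
    refine tsum_congr fun n => ?_
    have e : (2 * Real.pi : ℂ) = ((2 * Real.pi : ℝ) : ℂ) := by push_cast; rfl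
    rw [e, im_ofReal_mul, add_im, im_ofReal_mul, im_ofReal_mul, exp_ofReal_mul_I_im, ← neg_mul,
      ← ofReal_neg, exp_ofReal_mul_I_im, Real.sin_neg, inv_mul_cancel_left₀ (by positivity)]
    simp only [hd]
    ring
  have hleft : Tendsto (fun r : ℝ => ∑' n : ℕ, d n * r ^ (2 * n) * Real.sin (n * u)) (𝓝[<] 1)
      (𝓝 (∑' n : ℕ, d n * Real.sin (n * u))) := by
    refine tendsto_tsum_of_dominated_convergence H.summable_abs_sub_norm_taylorCoeff_sq
      (fun n => ?_) ?_
    · have : Tendsto (fun r : ℝ => d n * r ^ (2 * n) * Real.sin (n * u)) (𝓝[<] 1)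
          (𝓝 (d n * 1 ^ (2 * n) * Real.sin (n * u))) :=
        tendsto_nhdsWithin_of_tendsto_nhds (Continuous.tendsto (by fun_prop) 1)
      simpa using this
    · filter_upwards [hIoo] with r hr n
      have hr0 := hr.1
      rw [Real.norm_eq_abs, abs_mul, abs_mul, abs_of_nonneg (pow_nonneg hr.1.le _)]
      exact (mul_le_of_le_one_right (by positivity) (Real.abs_sin_le_one _)).trans
        (mul_le_of_le_one_right (abs_nonneg _) (pow_le_one₀ hr.1.le hr.2.le))
  have hright : Tendsto (fun r : ℝ => ∫ t in (0 : ℝ)..2 * Real.pi, (G r t).im) (𝓝[<] 1)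
      (𝓝 (∫ t in (0 : ℝ)..2 * Real.pi, Real.sin (ξ (t + u) - ξ t))) := by
    refine intervalIntegral.tendsto_integral_filter_of_dominated_convergence (fun _ => 1) ?_ ?_
      intervalIntegrable_const ?_
    · filter_upwards [hIoo] with r hr
      exact (Complex.continuous_im.comp (hGc r hr)).aestronglyMeasurable
    · filter_upwards [hIoo] with r hr
      refine Eventually.of_forall fun t _ => ?_
      have hb : ∀ t, ‖harmonicSum h g (circleMap 0 r t)‖ ≤ 1 := fun t =>
        (H.norm_lt_one (by simpa [abs_of_pos hr.1] using hr.2)).le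
      refine (Complex.abs_im_le_norm _).trans ?_
      rw [norm_mul, RCLike.norm_conj]
      exact mul_le_one₀ (hb _) (norm_nonneg _) (hb _)
    · filter_upwards [hS, ae_add_mem hS u] with t ht htu _
      have h1 := (Complex.continuous_im.tendsto _).comp
        (((Complex.continuous_conj.tendsto _).comp (hlim t ht)).mul (hlim _ htu))
      have e : (starRingEnd ℂ (exp (ξ t * I)) * exp (ξ (t + u) * I)).im =
          Real.sin (ξ (t + u) - ξ t) := by
        rw [← exp_conj, map_mul, conj_ofReal, conj_I, ← exp_add, ← exp_ofReal_mul_I_im]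
        congr 2
        push_cast
        ring
      rw [e] at h1
      exact h1
  have hle := integral_sin_sub_le hS hmono hper hu
  have heq := tendsto_nhds_unique hleft ((hright.const_mul (2 * Real.pi)⁻¹).congr' (by
    filter_upwards [hIoo] with r hr using (hseries r hr).symm))
  rw [heq, inv_mul_le_iff₀ (by positivity)]
  exact hle

/-- The area inequality for sense-preserving maps; in the case of equality the first coefficients
are extremal. -/
theorem volume_image_le (H : IsHarmonicDiscAut h g) {r : ℝ} (h0 : 0 < r) (h1 : r < 1) :
    volume (harmonicSum h g '' ball 0 r) ≤ volume (ball (0 : ℂ) r) ∧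
      (volume (harmonicSum h g '' ball 0 r) = volume (ball (0 : ℂ) r) →
        ‖taylorCoeff h 1‖ ^ 2 - ‖taylorCoeff g 1‖ ^ 2 = 1) := by
  obtain ⟨A, hA, hvol⟩ := H.exists_hasSum_volume_image h0 h1
  have hpi := Real.pi_pos
  have hs := H.summable_abs_sub_norm_taylorCoeff_sq
  have hφ : ∀ u : ℝ, Summable fun n : ℕ =>
      (‖taylorCoeff h n‖ ^ 2 - ‖taylorCoeff g n‖ ^ 2) * Real.sin (n * u) := fun u =>
    hs.of_norm_bounded fun n => by
      rw [Real.norm_eq_abs, abs_mul]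
      exact mul_le_of_le_one_right (abs_nonneg _) (Real.abs_sin_le_one _)
  have hball : volume (ball (0 : ℂ) r) = ENNReal.ofReal (Real.pi * r ^ 2) := by
    rw [Complex.volume_ball, mul_comm, ENNReal.ofReal_mul hpi.le, ENNReal.ofReal_pow h0.le]
    congr 1
    rw [← NNReal.coe_real_pi, ENNReal.ofReal_coe_nnreal]
  obtain ⟨hle, heq⟩ := tsum_le_of_sin_series_le hs (fun u => (hφ u).hasSum)
    (fun u hu => H.tsum_sin_le_sin hu) (by positivity) (by nlinarith : r ^ 2 < 1) hA
  rw [hvol, hball]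
  refine ⟨ENNReal.ofReal_le_ofReal (by gcongr), fun h => heq ?_⟩
  -- `ENNReal.ofReal` is injective only on nonnegative reals
  have hpos : 0 < Real.pi * r ^ 2 := by positivity
  rcases le_or_gt (Real.pi * A) 0 with h2 | h2
  · rw [ENNReal.ofReal_of_nonpos h2, eq_comm, ENNReal.ofReal_eq_zero] at h
    exact absurd h hpos.not_ge
  · exact mul_left_cancel₀ hpi.ne' ((ENNReal.ofReal_eq_ofReal_iff h2.le hpos.le).1 h)

/-- By the square sum bound, a unit first coefficient leaves no room for the others. -/
theorem exists_eq_mul (H : IsHarmonicDiscAut h g)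
    (h1 : ‖taylorCoeff h 1‖ ^ 2 - ‖taylorCoeff g 1‖ ^ 2 = 1) :
    ∃ a : ℂ, ‖a‖ = 1 ∧ ∀ z ∈ ball (0 : ℂ) 1, harmonicSum h g z = a * z := by
  have hone := H.sum_norm_taylorCoeff_sq_le_one {1}
  rw [Finset.sum_singleton] at hone
  have hb1 : ‖taylorCoeff g 1‖ ^ 2 = 0 := le_antisymm (by linarith) (sq_nonneg _)
  have ha1 : ‖taylorCoeff h 1‖ ^ 2 = 1 := by linarith
  have hn : ∀ n ≠ 1, ‖taylorCoeff h n‖ ^ 2 = 0 ∧ ‖taylorCoeff g n‖ ^ 2 = 0 := by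
    intro n hn
    have h2 := H.sum_norm_taylorCoeff_sq_le_one {n, 1}
    rw [Finset.sum_pair hn] at h2
    constructor <;> nlinarith [sq_nonneg ‖taylorCoeff h n‖, sq_nonneg ‖taylorCoeff g n‖]
  have hg0 : ∀ n, taylorCoeff g n = 0 := fun n => by
    rcases eq_or_ne n 1 with rfl | h2
    · simpa using hb1
    · simpa using (hn n h2).2
  refine ⟨taylorCoeff h 1, by nlinarith [norm_nonneg (taylorCoeff h 1)], fun z hz => ?_⟩
  rw [mem_ball_zero_iff] at hz
  have e1 : h z = taylorCoeff h 1 * z := by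
    refine (hasSum_taylorCoeff H.diff_left hz).unique ?_
    have := hasSum_single (f := fun n => taylorCoeff h n * z ^ n) 1 fun n h2 => by
      have : taylorCoeff h n = 0 := by simpa using (hn n h2).1
      simp [this]
    simpa using this
  have e2 : g z = 0 := by
    refine (hasSum_taylorCoeff H.diff_right hz).unique ?_
    simp [hg0]
  rw [harmonicSum, e1, e2, map_zero, add_zero]

end IsHarmonicDiscAut

/-- Conjugating a sense-reversing harmonic map exchanges its holomorphic and antiholomorphic parts;
the constants are redistributed so that the new antiholomorphic part vanishes at `0`. -/
theorem isHarmonicDiscAut_conj {h g : ℂ → ℂ} (hh : DifferentiableOn ℂ h (ball 0 1))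
    (hg : DifferentiableOn ℂ g (ball 0 1))
    (hbij : BijOn (harmonicSum h g) (ball 0 1) (ball 0 1))
    (hlt : ∀ z ∈ ball (0 : ℂ) 1, ‖deriv h z‖ < ‖deriv g z‖) :
    ∃ h₁ g₁ : ℂ → ℂ, IsHarmonicDiscAut h₁ g₁ ∧
      ∀ z, harmonicSum h₁ g₁ z = starRingEnd ℂ (harmonicSum h g z) := by
  have key : ∀ z, harmonicSum (fun z => g z + starRingEnd ℂ (h 0)) (fun z => h z - h 0) z =
      starRingEnd ℂ (harmonicSum h g z) := fun z => by
    simp only [harmonicSum, map_add, map_sub, conj_conj]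
    ring
  refine ⟨_, _, ⟨hg.add_const _, hh.sub_const _, sub_self _, ?_, fun z hz => ?_⟩, key⟩
  · have hconj : BijOn (starRingEnd ℂ) (ball 0 1) (ball 0 1) := by
      refine ⟨fun z hz => ?_, fun z _ w _ hzw => (starRingEnd ℂ).injective hzw, fun z hz => ?_⟩
      · simpa using hz
      · exact ⟨starRingEnd ℂ z, by simpa using hz, conj_conj z⟩
    exact (hconj.comp hbij).congr fun z _ => (key z).symm
  · rw [deriv_sub_const, deriv_add_const]
    exact hlt z hz

theorem volume_image_conj (s : Set ℂ) : volume (starRingEnd ℂ '' s) = volume s :=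
  (conjLIE.toEquiv.image_eq_preimage_symm s ▸
    conjLIE.symm.measurePreserving.measure_preimage_emb
      conjLIE.symm.toHomeomorph.measurableEmbedding s :)

end

theorem theorem1 (f : ℂ → ℂ)
    (hharm : InnerProductSpace.HarmonicOnNhd f (Metric.ball (0 : ℂ) 1))
    (hbij : Set.BijOn f (Metric.ball (0 : ℂ) 1) (Metric.ball (0 : ℂ) 1)) :
    (∀ r : ℝ, 0 < r → r < 1 →
      MeasureTheory.volume (f '' Metric.ball (0 : ℂ) r) ≤
        MeasureTheory.volume (Metric.ball (0 : ℂ) r)) ∧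
    ((∃ r : ℝ, 0 < r ∧ r < 1 ∧
      MeasureTheory.volume (f '' Metric.ball (0 : ℂ) r) =
        MeasureTheory.volume (Metric.ball (0 : ℂ) r)) →
      (∀ z ∈ Metric.ball (0 : ℂ) 1, ∀ w ∈ Metric.ball (0 : ℂ) 1,
        dist (f z) (f w) = dist z w) ∧
      ∃ a : ℂ, ‖a‖ = 1 ∧
        ((∀ z ∈ Metric.ball (0 : ℂ) 1, f z = a * z) ∨
          (∀ z ∈ Metric.ball (0 : ℂ) 1, f z = a * (starRingEnd ℂ) z))) := by
  obtain ⟨h, g, hh, hg, hg0, hfe⟩ := hharm.exists_eqOn_harmonicSum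
  have hb := hbij.congr hfe
  have hsub : ∀ {r : ℝ}, r < 1 → Metric.ball (0 : ℂ) r ⊆ Metric.ball 0 1 :=
    fun hr => Metric.ball_subset_ball hr.le
  rcases norm_deriv_lt_or_gt_of_injOn hh hg hb.injOn with hlt | hlt
  · have H : IsHarmonicDiscAut h g := ⟨hh, hg, hg0, hb, hlt⟩
    have himg : ∀ {r : ℝ}, r < 1 → f '' Metric.ball (0 : ℂ) r =
        harmonicSum h g '' Metric.ball 0 r := fun hr => Set.image_congr (hfe.mono (hsub hr))
    refine ⟨fun r h0 h1 => (himg h1).symm ▸ (H.volume_image_le h0 h1).1, ?_⟩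
    rintro ⟨r, h0, h1, heq⟩
    rw [himg h1] at heq
    obtain ⟨a, ha, haz⟩ := H.exists_eq_mul ((H.volume_image_le h0 h1).2 heq)
    have hfa : ∀ z ∈ Metric.ball (0 : ℂ) 1, f z = a * z := fun z hz => (hfe hz).trans (haz z hz)
    refine ⟨fun z hz w hw => ?_, a, ha, Or.inl hfa⟩
    rw [hfa z hz, hfa w hw, dist_eq_norm, dist_eq_norm, ← mul_sub, norm_mul, ha, one_mul]
  -- a sense-reversing map is replaced by its complex conjugate, with images of the same area
  · obtain ⟨h₁, g₁, H, hconj⟩ := isHarmonicDiscAut_conj hh hg hb hlt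
    have himg : ∀ {r : ℝ}, r < 1 → MeasureTheory.volume (f '' Metric.ball (0 : ℂ) r) =
        MeasureTheory.volume (harmonicSum h₁ g₁ '' Metric.ball 0 r) := fun hr => by
      rw [Set.image_congr (hfe.mono (hsub hr)), ← volume_image_conj, Set.image_image]
      simp_rw [hconj]
    refine ⟨fun r h0 h1 => (himg h1).symm ▸ (H.volume_image_le h0 h1).1, ?_⟩
    rintro ⟨r, h0, h1, heq⟩
    rw [himg h1] at heq
    obtain ⟨a, ha, haz⟩ := H.exists_eq_mul ((H.volume_image_le h0 h1).2 heq)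
    have hfa : ∀ z ∈ Metric.ball (0 : ℂ) 1, f z = starRingEnd ℂ a * starRingEnd ℂ z :=
      fun z hz => by
        rw [hfe hz, ← map_mul, ← haz z hz, hconj, Complex.conj_conj]
    have ha' : ‖starRingEnd ℂ a‖ = 1 := by rw [RCLike.norm_conj, ha]
    refine ⟨fun z hz w hw => ?_, starRingEnd ℂ a, ha', Or.inr hfa⟩
    rw [hfa z hz, hfa w hw, dist_eq_norm, dist_eq_norm, ← mul_sub, ← map_sub, norm_mul, ha',
      one_mul, RCLike.norm_conj]
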